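/- Rings are associative with unit, modules are unital left modules, and right $R$-modules are left $R^{op}$-modules. Let $R,S$ be rings and let $n,d$ be integers with $d\ge 1$ and $n>d+1$. A module $U$ over a ring $A$ is \emph{finitely $n$-presented} if there is an exact sequence $F_n\to\cdots\to F_1\to F_0\to U\to 0$ with all $F_i$ finitely generated free, and \emph{super finitely presented} if there is an infinite exact sequence $\cdots\to F_1\to F_0\to U\to 0$ with all $F_i$ finitely generated free; the $(d-1)$-th syzygy of $U$ in such a sequence is $\operatorname{Ker}(F_{d-1}\to F_{d-2})$, where $F_{-1}=U$. An $S$-module $I$ is \emph{$(n,d)$-injective} if $\operatorname{Ext}_S^{d+1}(U,I)=0$ for every finitely $n$-presented $S$-module $U$; an $R$-module $F$ is \emph{$(n,d)$-flat} if $\operatorname{Tor}^R_{d+1}(U,F)=0$ for every finitely $n$-presented right $R$-module $U$. An $(S,R)$-bimodule $K$ is \emph{semidualizing} if ${}_SK$ and $K_R$ have projective resolutions by finitely generated projective modules, the homothety maps $S\to\operatorname{Hom}_{R^{op}}(K,K)$ and $R\to\operatorname{Hom}_S(K,K)$ are bijective, and $\operatorname{Ext}^i_S(K,K)=0=\operatorname{Ext}^i_{R^{op}}(K,K)$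 for all $i\ge1$. Let $C$ be an $(S,R)$-bimodule that is super finitely presented as a left $S$-module and as a right $R$-module, and let $K=K_{d-1}$ be a semidualizing $(S,R)$-bimodule such that ${}_SK$ is isomorphic to a $(d-1)$-th syzygy of ${}_SC$ and $K_R$ is isomorphic to a $(d-1)$-th syzygy of $C_R$. An $R$-module is called \emph{$K_{d-1}$-$(n,d)$-injective} if it is isomorphic to $\operatorname{Hom}_S(K,I)$ for some $(n,d)$-injective $S$-module $I$, and an $S$-module is called \emph{$K_{d-1}$-$(n,d)$-flat} if it is isomorphic to $K\otimes_RF$ for some $(n,d)$-flat $R$-module $F$. \textbf{Proposition.} (1) If $0\to M\to N\to L\to 0$ is a short exact sequence of $R$-modules and $M$ and $L$ are $K_{d-1}$-$(n,d)$-injective, then $N$ is $K_{d-1}$-$(n,d)$-injective. (2) If $0\to M\to N\to L\to 0$ is a short exact sequence of $S$-modules and $M$ and $L$ are $K_{d-1}$-$(n,d)$-flat, then $N$ is $K_{d-1}$-$(n,d)$-flat. -/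

import Mathlib

open CategoryTheory MulOpposite
open scoped TensorProduct

universe u

noncomputable section

namespace NDModules

/-! Conventions: rings are associative with unit; a right `R`-module is a left module over `Rᵐᵒᵖ`
(so `m · r` is `op r • m`), and an `(S, R)`-bimodule is a type with commuting actions of `S` and
`Rᵐᵒᵖ`. -/

/-! ### Finitely `n`-presented and super finitely presented modules, syzygies -/

/-- `U` is finitely `n`-presented: there is an exact sequence
`F_n → F_{n-1} → ⋯ → F_1 → F_0 → U → 0` with every `F_i` finitely generated and free.
(The modules and maps of index larger than `n` are irrelevant: nothing is required of them.) -/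
def FinitelyNPresented (A : Type u) [Ring A] (n : ℕ) (U : Type u) [AddCommGroup U] [Module A U] :
    Prop :=
  ∃ (r : ℕ → ℕ) (ε : (Fin (r 0) → A) →ₗ[A] U)
    (f : ∀ i, (Fin (r (i + 1)) → A) →ₗ[A] (Fin (r i) → A)),
    Function.Surjective ε ∧ (0 < n → Function.Exact (f 0) ε) ∧
      ∀ i, i + 1 < n → Function.Exact (f (i + 1)) (f i)

/-- An exact sequence `⋯ → F_2 → F_1 → F_0 → U → 0` with every `F_i` finitely generated
and free. -/
structure FiniteFreeResolution (A : Type u) [Ring A] (U : Type u) [AddCommGroup U] [Module A U] where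
  rank : ℕ → ℕ
  aug : (Fin (rank 0) → A) →ₗ[A] U
  diff : ∀ i, (Fin (rank (i + 1)) → A) →ₗ[A] (Fin (rank i) → A)
  aug_surjective : Function.Surjective aug
  exact_zero : Function.Exact (diff 0) aug
  exact_succ : ∀ i, Function.Exact (diff (i + 1)) (diff i)

/-- `U` is super finitely presented. -/
def SuperFinitelyPresented (A : Type u) [Ring A] (U : Type u) [AddCommGroup U] [Module A U] :
    Prop :=
  Nonempty (FiniteFreeResolution A U)

/-- The `i`-th syzygy `K_i` of a resolution: `K_0 = Ker (F_0 → U)` and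
`K_i = Ker (F_i → F_{i-1})` for `i ≥ 1`. -/
def FiniteFreeResolution.syzygy {A : Type u} [Ring A] {U : Type u} [AddCommGroup U] [Module A U]
    (F : FiniteFreeResolution A U) : (i : ℕ) → Submodule A (Fin (F.rank i) → A)
  | 0 => LinearMap.ker F.aug
  | i + 1 => LinearMap.ker (F.diff i)

/-- `K` is (isomorphic to) the `i`-th syzygy of `U` in some resolution of `U` by finitely generated
free modules. -/
def IsSyzygy (A : Type u) [Ring A] (i : ℕ) (U K : Type u) [AddCommGroup U] [Module A U]
    [AddCommGroup K] [Module A K] : Prop :=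
  ∃ F : FiniteFreeResolution A U, Nonempty (K ≃ₗ[A] F.syzygy i)

/-! ### Semidualizing bimodules -/

/-- `C` has a projective resolution by finitely generated projective `A`-modules. -/
def HasDegreewiseFiniteProjectiveResolution (A : Type u) [Ring A] (C : Type u) [AddCommGroup C]
    [Module A C] : Prop :=
  ∃ P : ProjectiveResolution (ModuleCat.of A C), ∀ i, Module.Finite A (P.complex.X i)

/-- Semidualizing `(S, R)`-bimodules. -/
structure IsSemidualizing (S R : Type u) [Ring S] [Ring R] (C : Type u) [AddCommGroup C]
    [Module S C] [Module Rᵐᵒᵖ C] [SMulCommClass S Rᵐᵒᵖ C] : Prop where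
  resolution_left : HasDegreewiseFiniteProjectiveResolution S C
  resolution_right : HasDegreewiseFiniteProjectiveResolution Rᵐᵒᵖ C
  /-- the homothety `S → Hom_{Rᵒᵖ}(C, C)`, `s ↦ (c ↦ s c)`, is an isomorphism -/
  homothety_left : Function.Bijective
    (fun s : S => (DistribSMul.toLinearMap Rᵐᵒᵖ C s : C →ₗ[Rᵐᵒᵖ] C))
  /-- the homothety `R → Hom_S(C, C)`, `r ↦ (c ↦ c r)`, is an isomorphism -/
  homothety_right :
    haveI : SMulCommClass Rᵐᵒᵖ S C := SMulCommClass.symm S Rᵐᵒᵖ C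
    Function.Bijective (fun r : R => (DistribSMul.toLinearMap S C (op r) : C →ₗ[S] C))
  ext_left : ∀ i : ℕ, 1 ≤ i → Subsingleton (Abelian.Ext (ModuleCat.of S C) (ModuleCat.of S C) i)
  ext_right : ∀ i : ℕ, 1 ≤ i →
    Subsingleton (Abelian.Ext (ModuleCat.of Rᵐᵒᵖ C) (ModuleCat.of Rᵐᵒᵖ C) i)

/-- For `d ≥ 1`: the `(S, R)`-bimodule `C` is super finitely presented (on both sides), and the
`(S, R)`-bimodule `K` is a `(d-1)`-th syzygy `K_{d-1}` of `C` (on both sides) and is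
semidualizing. -/
structure IsSpecialSemidualizing (S R : Type u) [Ring S] [Ring R] (d : ℕ)
    (C : Type u) [AddCommGroup C] [Module S C] [Module Rᵐᵒᵖ C] [SMulCommClass S Rᵐᵒᵖ C]
    (K : Type u) [AddCommGroup K] [Module S K] [Module Rᵐᵒᵖ K] [SMulCommClass S Rᵐᵒᵖ K] :
    Prop where
  super_left : SuperFinitelyPresented S C
  super_right : SuperFinitelyPresented Rᵐᵒᵖ C
  syzygy_left : IsSyzygy S (d - 1) C K
  syzygy_right : IsSyzygy Rᵐᵒᵖ (d - 1) C K
  semidualizing : IsSemidualizing S R K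

/-! ### The left `R`-module `Hom_S(K, I)` -/

/-- `Hom_S(K, I)` for an `(S, R)`-bimodule `K`, with its left `R`-module structure
`(r • f) k = f (k r)`. -/
def HomMod (S R K I : Type u) [Ring S] [Ring R] [AddCommGroup K] [Module S K] [Module Rᵐᵒᵖ K]
    [SMulCommClass S Rᵐᵒᵖ K] [AddCommGroup I] [Module S I] : Type u :=
  K →ₗ[S] I

section HomMod

variable (S R K I : Type u) [Ring S] [Ring R] [AddCommGroup K] [Module S K] [Module Rᵐᵒᵖ K]
  [SMulCommClass S Rᵐᵒᵖ K] [AddCommGroup I] [Module S I]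

instance : AddCommGroup (HomMod S R K I) := inferInstanceAs (AddCommGroup (K →ₗ[S] I))

instance : FunLike (HomMod S R K I) K I := inferInstanceAs (FunLike (K →ₗ[S] I) K I)

instance : SMul R (HomMod S R K I) where
  smul r f :=
    { toFun := fun k => f (op r • k)
      map_add' := fun k l => by
        rw [smul_add]; exact LinearMap.map_add (f : K →ₗ[S] I) _ _
      map_smul' := fun s k => by
        rw [← smul_comm s (op r) k]; exact LinearMap.map_smul (f : K →ₗ[S] I) _ _ }

theorem HomMod.smul_apply (r : R) (f : HomMod S R K I) (k : K) : (r • f) k = f (op r • k) := rfl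

theorem HomMod.ext {f g : HomMod S R K I} (h : ∀ k, f k = g k) : f = g :=
  LinearMap.ext (f := (f : K →ₗ[S] I)) (g := (g : K →ₗ[S] I)) h

instance : Module R (HomMod S R K I) where
  one_smul f := HomMod.ext S R K I fun k => by rw [HomMod.smul_apply, op_one, one_smul]
  mul_smul a b f := HomMod.ext S R K I fun k => by
    rw [HomMod.smul_apply, HomMod.smul_apply, HomMod.smul_apply, op_mul, mul_smul]
  smul_zero r := HomMod.ext S R K I fun k => rfl
  smul_add r f g := HomMod.ext S R K I fun k => rfl
  add_smul a b f := HomMod.ext S R K I fun k => by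
    change f (op (a + b) • k) = f (op a • k) + f (op b • k)
    rw [MulOpposite.op_add, add_smul]
    exact LinearMap.map_add (f : K →ₗ[S] I) _ _
  zero_smul f := HomMod.ext S R K I fun k => by
    rw [HomMod.smul_apply, op_zero, zero_smul]
    exact LinearMap.map_zero (f : K →ₗ[S] I)

end HomMod

/-! ### The left `S`-module `K ⊗_R F` over a non-commutative ring `R` -/

/-- The `S`-submodule of `K ⊗_ℤ F` generated by the elements `k r ⊗ x - k ⊗ r x`. -/
def balancedRel (S R K F : Type u) [Ring S] [Ring R] [AddCommGroup K] [Module S K]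
    [Module Rᵐᵒᵖ K] [AddCommGroup F] [Module R F] : Submodule S (K ⊗[ℤ] F) :=
  Submodule.span S
    {t | ∃ (k : K) (r : R) (x : F), t = (op r • k) ⊗ₜ[ℤ] x - k ⊗ₜ[ℤ] (r • x)}

/-- `K ⊗_R F` for an `(S, R)`-bimodule `K` and a left `R`-module `F`, a left `S`-module. Since the
actions of `S` and `R` on `K` commute, the generators of `balancedRel` are permuted by `S`, so
the quotient is the usual balanced tensor product. -/
abbrev TensorMod (S R K F : Type u) [Ring S] [Ring R] [AddCommGroup K] [Module S K]
    [Module Rᵐᵒᵖ K] [SMulCommClass S Rᵐᵒᵖ K] [AddCommGroup F] [Module R F] : Type u :=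
  (K ⊗[ℤ] F) ⧸ balancedRel S R K F

/-! ### `Tor` over a non-commutative ring -/

/-- The relations of `U ⊗_R N` for a right `R`-module `U`, as a subgroup of `U ⊗_ℤ N`. -/
def torRel (R U N : Type u) [Ring R] [AddCommGroup U] [Module Rᵐᵒᵖ U] [AddCommGroup N]
    [Module R N] : Submodule ℤ (U ⊗[ℤ] N) :=
  Submodule.span ℤ
    {t | ∃ (k : U) (r : R) (x : N), t = (op r • k) ⊗ₜ[ℤ] x - k ⊗ₜ[ℤ] (r • x)}

theorem torRel_le_comap (R N : Type u) [Ring R] [AddCommGroup N] [Module R N] {U V : Type u}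
    [AddCommGroup U] [Module Rᵐᵒᵖ U] [AddCommGroup V] [Module Rᵐᵒᵖ V] (g : U →ₗ[Rᵐᵒᵖ] V) :
    torRel R U N ≤ (torRel R V N).comap
      (TensorProduct.map g.toAddMonoidHom.toIntLinearMap (LinearMap.id : N →ₗ[ℤ] N)) := by
  refine Submodule.span_le.2 ?_
  rintro _ ⟨k, r, x, rfl⟩
  refine Submodule.subset_span ⟨g k, r, x, ?_⟩
  simp

/-- The map `U ⊗_R N → V ⊗_R N` induced by a map `g : U → V` of right `R`-modules. -/
def tensorMap (R N : Type u) [Ring R] [AddCommGroup N] [Module R N] {U V : Type u}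
    [AddCommGroup U] [Module Rᵐᵒᵖ U] [AddCommGroup V] [Module Rᵐᵒᵖ V] (g : U →ₗ[Rᵐᵒᵖ] V) :
    ((U ⊗[ℤ] N) ⧸ torRel R U N) →ₗ[ℤ] ((V ⊗[ℤ] N) ⧸ torRel R V N) :=
  (torRel R U N).mapQ (torRel R V N) _ (torRel_le_comap R N g)

theorem tensorMap_tmul (R N : Type u) [Ring R] [AddCommGroup N] [Module R N] {U V : Type u}
    [AddCommGroup U] [Module Rᵐᵒᵖ U] [AddCommGroup V] [Module Rᵐᵒᵖ V] (g : U →ₗ[Rᵐᵒᵖ] V)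
    (a : U) (x : N) :
    tensorMap R N g ((torRel R U N).mkQ (a ⊗ₜ[ℤ] x)) = (torRel R V N).mkQ (g a ⊗ₜ[ℤ] x) := rfl

theorem tensor_hom_ext (R N : Type u) [Ring R] [AddCommGroup N] [Module R N] {U W : Type u}
    [AddCommGroup U] [Module Rᵐᵒᵖ U] [AddCommGroup W] [Module ℤ W]
    {p q : ((U ⊗[ℤ] N) ⧸ torRel R U N) →ₗ[ℤ] W}
    (h : ∀ (a : U) (x : N), p ((torRel R U N).mkQ (a ⊗ₜ[ℤ] x)) =
      q ((torRel R U N).mkQ (a ⊗ₜ[ℤ] x))) : p = q :=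
  Submodule.linearMap_qext _ (TensorProduct.ext' h)

/-- The functor `U ↦ U ⊗_R N` from right `R`-modules to abelian groups. -/
def tensorFunctor (R N : Type u) [Ring R] [AddCommGroup N] [Module R N] :
    ModuleCat.{u} Rᵐᵒᵖ ⥤ ModuleCat.{u} ℤ where
  obj U := ModuleCat.of ℤ ((U ⊗[ℤ] N) ⧸ torRel R U N)
  map g := ModuleCat.ofHom (tensorMap R N g.hom)
  map_id _ := ModuleCat.hom_ext (tensor_hom_ext R N fun _ _ => rfl)
  map_comp _ _ := ModuleCat.hom_ext (tensor_hom_ext R N fun _ _ => rfl)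

instance (R N : Type u) [Ring R] [AddCommGroup N] [Module R N] :
    (tensorFunctor R N).Additive where
  map_add {U V f g} := ModuleCat.hom_ext (tensor_hom_ext R N fun a x => by
    change (torRel R V N).mkQ ((f.hom a + g.hom a) ⊗ₜ[ℤ] x) =
      (torRel R V N).mkQ (f.hom a ⊗ₜ[ℤ] x) + (torRel R V N).mkQ (g.hom a ⊗ₜ[ℤ] x)
    rw [TensorProduct.add_tmul, map_add])

/-- `Tor_i^R(U, N)`, for a right `R`-module `U` and a left `R`-module `N`: the `i`-th left derived
functor of `- ⊗_R N`, evaluated at `U`. -/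
def TorMod (R : Type u) [Ring R] (i : ℕ) (U N : Type u) [AddCommGroup U] [Module Rᵐᵒᵖ U]
    [AddCommGroup N] [Module R N] : ModuleCat.{u} ℤ :=
  ((tensorFunctor R N).leftDerived i).obj (ModuleCat.of Rᵐᵒᵖ U)

/-! ### `(n, d)`-injective and `(n, d)`-flat modules, and their relative versions -/

/-- The left `S`-module `I` is `(n, d)`-injective: `Ext_S^{d+1}(U, I) = 0` for every finitely
`n`-presented left `S`-module `U`. -/
def IsNDInjective (S : Type u) [Ring S] (n d : ℕ) (I : Type u) [AddCommGroup I] [Module S I] :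
    Prop :=
  ∀ (U : Type u) [AddCommGroup U] [Module S U], FinitelyNPresented S n U →
    Subsingleton (Abelian.Ext (ModuleCat.of S U) (ModuleCat.of S I) (d + 1))

/-- The left `R`-module `F` is `(n, d)`-flat: `Tor^R_{d+1}(U, F) = 0` for every finitely
`n`-presented right `R`-module `U`. -/
def IsNDFlat (R : Type u) [Ring R] (n d : ℕ) (F : Type u) [AddCommGroup F] [Module R F] : Prop :=
  ∀ (U : Type u) [AddCommGroup U] [Module Rᵐᵒᵖ U], FinitelyNPresented Rᵐᵒᵖ n U →
    Subsingleton (TorMod R (d + 1) U F)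

/-- The left `R`-module `M` is `K`-`(n, d)`-injective: `M ≅ Hom_S(K, I)` for some
`(n, d)`-injective left `S`-module `I`. -/
def IsRelNDInjective (S R K : Type u) [Ring S] [Ring R] [AddCommGroup K] [Module S K]
    [Module Rᵐᵒᵖ K] [SMulCommClass S Rᵐᵒᵖ K] (n d : ℕ) (M : Type u) [AddCommGroup M]
    [Module R M] : Prop :=
  ∃ (I : Type u) (_ : AddCommGroup I) (_ : Module S I),
    IsNDInjective S n d I ∧ Nonempty (M ≃ₗ[R] HomMod S R K I)

/-- The left `S`-module `N` is `K`-`(n, d)`-flat: `N ≅ K ⊗_R F` for some `(n, d)`-flat left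
`R`-module `F`. -/
def IsRelNDFlat (S R K : Type u) [Ring S] [Ring R] [AddCommGroup K] [Module S K]
    [Module Rᵐᵒᵖ K] [SMulCommClass S Rᵐᵒᵖ K] (n d : ℕ) (N : Type u) [AddCommGroup N]
    [Module S N] : Prop :=
  ∃ (F : Type u) (_ : AddCommGroup F) (_ : Module R F),
    IsNDFlat R n d F ∧ Nonempty (N ≃ₗ[S] TensorMod S R K F)

end NDModules

end

/-! Both parts are an instance of Foxby duality. The functors `K ⊗_R -` and `Hom_S(K, -)` are
mutually inverse on the modules in question and exact enough to carry a short exact sequence across.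
The middle term there is an extension of (n,d)-injective (or (n,d)-flat) modules, hence of the same
kind, and a diagram chase identifies its image with N.

The input on an (n,d)-injective module I is `ExtAcyclic`. Dimension shifting gives Ext^{>d}(U,I) = 0
for every U finitely presented to all orders. As K is a (d-1)-th syzygy of such a module,
Ext^{≥1}(K,I) = 0. No bound on an injective dimension of I is available. What replaces it is
`DualFinite`: the modules X whose dual X* = Hom(X,K) is finitely presented to all orders, with
Ext^{≥1}(X,K) = 0. It contains K, since K* is the base ring, and is closed under syzygies. A cover
with kernel X' yields 0 → X* → K^r → X'* → 0. Hence Ext^j(X*,I) is controlled by Ext^{j+1}(X'*,I),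
and climbing past degree d gives Ext^{≥1}(X*,I) = 0 (`DualFinite.extZero`).

For (1), this makes X ⊗ Hom_S(K,I) → Hom_S(X*,I) bijective by comparison with free modules. At X = K
it gives K ⊗ Hom_S(K,I) ≅ I and Tor_1(K, Hom_S(K,I)) = 0. Thus K ⊗ - keeps the sequence exact, and N
≅ Hom_S(K, K ⊗ N).

For (2), F is (n,d)-flat iff its character module is (n,d)-injective over the opposite ring. The
same vanishing makes X* ⊗ F → Hom_S(X, K ⊗ F) bijective. So F ≅ Hom_S(K, K ⊗ F) and Ext^1_S(K, K ⊗
F) = 0. Thus Hom_S(K,-) keeps the sequence exact, and K ⊗ Hom_S(K,N) ≅ N. -/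

noncomputable section

namespace NDModules

/-! ### Vanishing of Ext along short exact sequences -/

section ExtVanishing

variable {A : Type u} [Ring A]

/-- `Ext_A^i(U, X) = 0`. -/
abbrev ExtZero (A : Type u) [Ring A] (U X : Type u) [AddCommGroup U] [Module A U]
    [AddCommGroup X] [Module A X] (i : ℕ) : Prop :=
  Subsingleton (Abelian.Ext (ModuleCat.of A U) (ModuleCat.of A X) i)

variable {X Y Z U I : Type u} [AddCommGroup X] [Module A X] [AddCommGroup Y] [Module A Y]
  [AddCommGroup Z] [Module A Z] [AddCommGroup U] [Module A U] [AddCommGroup I] [Module A I]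

/-- The short complex of modules attached to an exact pair of linear maps. -/
abbrev shortComplexOfExact {f : X →ₗ[A] Y} {g : Y →ₗ[A] Z} (hfg : Function.Exact f g) :
    ShortComplex (ModuleCat.{u} A) :=
  ModuleCat.shortComplexOfCompEqZero f g hfg.linearMap_comp_eq_zero

theorem shortExact_shortComplexOfExact {f : X →ₗ[A] Y} {g : Y →ₗ[A] Z}
    (hf : Function.Injective f) (hfg : Function.Exact f g) (hg : Function.Surjective g) :
    (shortComplexOfExact hfg).ShortExact :=
  ModuleCat.shortComplex_shortExact _ hfg hf hg

variable {f : X →ₗ[A] Y} {g : Y →ₗ[A] Z}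

theorem ExtZero.of_middle_of_right (hf : Function.Injective f) (hfg : Function.Exact f g)
    (hg : Function.Surjective g) {i : ℕ} (hY : ExtZero A Y I i) (hZ : ExtZero A Z I (i + 1)) :
    ExtZero A X I i := by
  refine subsingleton_of_forall_eq 0 fun x => ?_
  obtain ⟨y, hy⟩ := Abelian.Ext.contravariant_sequence_exact₁
    (shortExact_shortComplexOfExact hf hfg hg) (ModuleCat.of A I) x (add_comm 1 i)
    (Subsingleton.elim _ _)
  rw [← hy, Subsingleton.elim y 0, Abelian.Ext.comp_zero]

theorem ExtZero.of_left_of_middle (hf : Function.Injective f) (hfg : Function.Exact f g)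
    (hg : Function.Surjective g) {i : ℕ} (hX : ExtZero A X I i) (hY : ExtZero A Y I (i + 1)) :
    ExtZero A Z I (i + 1) := by
  refine subsingleton_of_forall_eq 0 fun z => ?_
  obtain ⟨x, hx⟩ := Abelian.Ext.contravariant_sequence_exact₃
    (shortExact_shortComplexOfExact hf hfg hg) (ModuleCat.of A I) z
    (Subsingleton.elim _ _) (add_comm 1 i)
  rw [← hx, Subsingleton.elim x 0, Abelian.Ext.comp_zero]

theorem ExtZero.of_left_of_right (hf : Function.Injective f) (hfg : Function.Exact f g)
    (hg : Function.Surjective g) {i : ℕ} (hX : ExtZero A X I i) (hZ : ExtZero A Z I i) :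
    ExtZero A Y I i := by
  refine subsingleton_of_forall_eq 0 fun y => ?_
  obtain ⟨z, hz⟩ := Abelian.Ext.contravariant_sequence_exact₂
    (shortExact_shortComplexOfExact hf hfg hg) (ModuleCat.of A I) y (Subsingleton.elim _ _)
  rw [← hz, Subsingleton.elim z 0, Abelian.Ext.comp_zero]

theorem ExtZero.target_of_left_of_right (hf : Function.Injective f) (hfg : Function.Exact f g)
    (hg : Function.Surjective g) {i : ℕ} (hX : ExtZero A U X i) (hZ : ExtZero A U Z i) :
    ExtZero A U Y i := by
  refine subsingleton_of_forall_eq 0 fun y => ?_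
  obtain ⟨x, hx⟩ := Abelian.Ext.covariant_sequence_exact₂ (ModuleCat.of A U)
    (shortExact_shortComplexOfExact hf hfg hg) y (Subsingleton.elim _ _)
  rw [← hx, Subsingleton.elim x 0, Abelian.Ext.zero_comp]

/-- The obstruction to extending h is its image under the connecting map Hom(X,I) → Ext^1(Z,I). -/
theorem ExtZero.exists_extension (hf : Function.Injective f) (hfg : Function.Exact f g)
    (hg : Function.Surjective g) (hZ : ExtZero A Z I 1) (h : X →ₗ[A] I) :
    ∃ h' : Y →ₗ[A] I, h' ∘ₗ f = h := by
  obtain ⟨y, hy⟩ := Abelian.Ext.contravariant_sequence_exact₁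
    (shortExact_shortComplexOfExact hf hfg hg) (ModuleCat.of A I)
    (Abelian.Ext.mk₀ (ModuleCat.ofHom h)) (add_comm 1 0) (Subsingleton.elim _ _)
  obtain ⟨y, rfl⟩ := (Abelian.Ext.mk₀_bijective _ _).2 y
  rw [Abelian.Ext.mk₀_comp_mk₀] at hy
  have := (Abelian.Ext.mk₀_bijective _ _).1 hy
  exact ⟨y.hom, congrArg ModuleCat.Hom.hom this⟩

theorem ExtZero.congr_left (e : X ≃ₗ[A] Y) {i : ℕ} (h : ExtZero A X I i) : ExtZero A Y I i := by
  refine subsingleton_of_forall_eq 0 fun y => ?_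
  rw [← Abelian.Ext.mk₀_id_comp y,
    show 𝟙 (ModuleCat.of A Y) = e.toModuleIso.inv ≫ e.toModuleIso.hom from
      e.toModuleIso.inv_hom_id.symm, ← Abelian.Ext.mk₀_comp_mk₀_assoc,
    Subsingleton.elim ((Abelian.Ext.mk₀ e.toModuleIso.hom).comp y _) 0, Abelian.Ext.comp_zero]

theorem ExtZero.congr_right (e : X ≃ₗ[A] Y) {i : ℕ} (h : ExtZero A U X i) : ExtZero A U Y i := by
  -- An isomorphism is a short exact sequence with zero third term.
  refine ExtZero.target_of_left_of_right (f := (e : X →ₗ[A] Y)) (g := (0 : Y →ₗ[A] PUnit.{u + 1}))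
    e.injective ?_ (fun x => ⟨0, Subsingleton.elim _ _⟩) h ?_
  · exact fun y => ⟨fun _ => e.surjective y, fun _ => rfl⟩
  · refine subsingleton_of_forall_eq 0 fun y => ?_
    rw [← Abelian.Ext.comp_mk₀_id y,
      show 𝟙 (ModuleCat.of A PUnit.{u + 1}) = 0 from
        ModuleCat.hom_ext (LinearMap.ext fun _ => rfl), Abelian.Ext.mk₀_zero,
      Abelian.Ext.comp_zero]

theorem ExtZero.of_projective [Module.Projective A U] (i : ℕ) : ExtZero A U I (i + 1) := by
  have : Projective (ModuleCat.of A U) := (IsProjective.iff_projective U).1 inferInstance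
  exact Abelian.Ext.subsingleton_of_projective _ _ _

/-- A class of modules that contains the zero modules and is closed under isomorphisms and
extensions is closed under finite powers. -/
theorem pow_induction {P : ∀ (M : Type u) [AddCommGroup M] [Module A M], Prop}
    (zero : ∀ (M : Type u) [AddCommGroup M] [Module A M], Subsingleton M → P M)
    (extension : ∀ (M N L : Type u) [AddCommGroup M] [Module A M] [AddCommGroup N] [Module A N]
      [AddCommGroup L] [Module A L] (f : M →ₗ[A] N) (g : N →ₗ[A] L), Function.Injective f →
      Function.Exact f g → Function.Surjective g → P M → P L → P N)
    (hX : P X) (q : ℕ) : P (Fin q → X) := by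
  induction q with
  | zero => exact zero _ inferInstance
  | succ q ih =>
    -- The split sequence 0 → X → X^{q+1} → X^q → 0 given by the zeroth coordinate.
    refine extension X (Fin (q + 1) → X) (Fin q → X) (LinearMap.single A (fun _ => X) 0)
      (LinearMap.funLeft A X Fin.succ) (Pi.single_injective (M := fun _ => X) 0) (fun v => ⟨fun h => ⟨v 0, ?_⟩, ?_⟩)
      (LinearMap.funLeft_surjective_of_injective _ _ _ (Fin.succ_injective q)) hX ih
    · refine funext (Fin.cases ?_ fun j => ?_)
      · simp
      · simpa using (congrFun h j).symm
    · rintro ⟨x, rfl⟩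
      ext j
      simp [LinearMap.funLeft_apply]

theorem ExtZero.of_subsingleton (M : Type u) [AddCommGroup M] [Module A M] [Subsingleton M]
    (i : ℕ) : ExtZero A M I i := by
  refine subsingleton_of_forall_eq 0 fun y => ?_
  rw [← Abelian.Ext.mk₀_id_comp y,
    show 𝟙 (ModuleCat.of A M) = 0 from
      ModuleCat.hom_ext (LinearMap.ext fun _ => Subsingleton.elim (α := M) _ _),
      Abelian.Ext.mk₀_zero, Abelian.Ext.zero_comp]

theorem ExtZero.pi {i : ℕ} (hX : ExtZero A X I i) (q : ℕ) : ExtZero A (Fin q → X) I i :=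
  pow_induction (P := fun M _ _ => ExtZero A M I i) (fun M _ _ _ => ExtZero.of_subsingleton M i)
    (fun _ _ _ _ _ _ _ _ _ _ _ hf hfg hg hM hL => ExtZero.of_left_of_right hf hfg hg hM hL) hX q

end ExtVanishing

/-! ### Finite presentations, syzygies and dimension shifting -/

section Presentations

variable {A : Type u} [Ring A]

/-- `U` is finitely `n`-presented, defined recursively: `U` is the image of a finitely generated
free module whose kernel is finitely `(n - 1)`-presented. -/
def NPres (A : Type u) [Ring A] : ℕ → ∀ (U : Type u) [AddCommGroup U] [Module A U], Prop
  | 0, U, _, _ => ∃ (r : ℕ) (f : (Fin r → A) →ₗ[A] U), Function.Surjective f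
  | n + 1, U, _, _ => ∃ (r : ℕ) (f : (Fin r → A) →ₗ[A] U), Function.Surjective f ∧
      NPres A n (LinearMap.ker f)

variable {X Y Z U : Type u} [AddCommGroup X] [Module A X] [AddCommGroup Y] [Module A Y]
  [AddCommGroup Z] [Module A Z] [AddCommGroup U] [Module A U]

theorem NPres.congr {n : ℕ} (e : X ≃ₗ[A] Y) (h : NPres A n X) : NPres A n Y := by
  cases n with
  | zero =>
    obtain ⟨r, f, hf⟩ := h
    exact ⟨r, e.toLinearMap ∘ₗ f, e.surjective.comp hf⟩
  | succ n =>
    obtain ⟨r, f, hf, hk⟩ := h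
    refine ⟨r, e.toLinearMap ∘ₗ f, e.surjective.comp hf, ?_⟩
    rwa [LinearEquiv.ker_comp]

/-- An injective map identifies its source with the kernel of the next map in an exact sequence. -/
def equivKer {f : X →ₗ[A] Y} {g : Y →ₗ[A] Z} (hf : Function.Injective f)
    (hfg : Function.Exact f g) : X ≃ₗ[A] LinearMap.ker g :=
  (LinearEquiv.ofInjective f hf).trans (LinearEquiv.ofEq _ _ (LinearMap.exact_iff.1 hfg).symm)

/-- A presentation of the kernel is spliced onto the cover. Only this direction is needed: the
recursive notion is used to produce modules on which (n,d)-injectivity can be tested. -/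
theorem NPres.finitelyNPresented {n : ℕ} (h : NPres A n U) : FinitelyNPresented A n U := by
  induction n generalizing U with
  | zero =>
    obtain ⟨r, f, hf⟩ := h
    exact ⟨fun _ => r, f, fun _ => 0, hf, fun h => absurd h (lt_irrefl _),
      fun i h => absurd h (Nat.not_lt_zero _)⟩
  | succ n ih =>
    obtain ⟨r, f, hf, hk⟩ := h
    obtain ⟨r', ε, δ, hε, h0, hs⟩ := ih hk
    refine ⟨fun | 0 => r | i + 1 => r' i, f,
      fun | 0 => (LinearMap.ker f).subtype ∘ₗ ε | i + 1 => δ i, hf, fun _ x => ?_, ?_⟩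
    · constructor
      · intro hx
        obtain ⟨y, hy⟩ := hε ⟨x, hx⟩
        exact ⟨y, congrArg Subtype.val hy⟩
      · rintro ⟨y, rfl⟩
        exact (ε y).2
    · rintro (_ | i) hi
      · intro x
        rw [← h0 (by omega) x]
        exact Submodule.coe_eq_zero
      · exact hs i (by omega)

theorem NPres.of_exact {n r : ℕ} {f : X →ₗ[A] (Fin r → A)} {g : (Fin r → A) →ₗ[A] Z}
    (hf : Function.Injective f) (hfg : Function.Exact f g) (hg : Function.Surjective g)
    (hX : NPres A n X) : NPres A (n + 1) Z :=
  ⟨r, g, hg, hX.congr (equivKer hf hfg)⟩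

theorem NPres.of_subsingleton (n : ℕ) (M : Type u) [AddCommGroup M] [Module A M] [Subsingleton M] :
    NPres A n M := by
  induction n generalizing M with
  | zero => exact ⟨0, 0, fun x => ⟨0, Subsingleton.elim _ _⟩⟩
  | succ n ih => exact ⟨0, 0, fun x => ⟨0, Subsingleton.elim _ _⟩, ih _⟩

theorem NPres.free (n r : ℕ) : NPres A n (Fin r → A) := by
  cases n with
  | zero => exact ⟨r, LinearMap.id, Function.surjective_id⟩
  | succ n =>
    have : Subsingleton (LinearMap.ker (LinearMap.id : (Fin r → A) →ₗ[A] (Fin r → A))) := by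
      rw [LinearMap.ker_id]; infer_instance
    exact ⟨r, LinearMap.id, Function.surjective_id, NPres.of_subsingleton n _⟩

theorem NPres.self (n : ℕ) : NPres A n A :=
  (NPres.free n 1).congr (LinearEquiv.funUnique (Fin 1) A A)

/-- The isomorphism `A^(a+b) ≅ A^a × A^b`. -/
def finAddEquiv (A : Type u) [Ring A] (a b : ℕ) :
    (Fin (a + b) → A) ≃ₗ[A] (Fin a → A) × (Fin b → A) :=
  (LinearEquiv.funCongrLeft A A finSumFinEquiv).trans (LinearEquiv.sumArrowLequivProdArrow _ _ A A)

theorem NPres.of_prod {n a b : ℕ} (f : (Fin a → A) × (Fin b → A) →ₗ[A] U)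
    (hf : Function.Surjective f) (hk : NPres A n (LinearMap.ker f)) : NPres A (n + 1) U := by
  refine NPres.of_exact (f := (finAddEquiv A a b).symm.toLinearMap ∘ₗ (LinearMap.ker f).subtype)
    (g := f ∘ₗ (finAddEquiv A a b).toLinearMap)
    ((finAddEquiv A a b).symm.injective.comp (Submodule.subtype_injective _)) (fun x => ?_)
    (hf.comp (finAddEquiv A a b).surjective) hk
  constructor
  · exact fun hx => ⟨⟨finAddEquiv A a b x, hx⟩, by simp⟩
  · rintro ⟨y, rfl⟩
    simp

/-- Horseshoe argument: a lift of the cover of Z to Y, together with the cover of X, covers Y, and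
the three kernels again form a short exact sequence. -/
theorem NPres.extension {n : ℕ} {f : X →ₗ[A] Y} {g : Y →ₗ[A] Z} (hf : Function.Injective f)
    (hfg : Function.Exact f g) (hg : Function.Surjective g) (hX : NPres A n X)
    (hZ : NPres A n Z) : NPres A n Y := by
  induction n generalizing X Y Z with
  | zero =>
    obtain ⟨a, p, hp⟩ := hX
    obtain ⟨b, q, hq⟩ := hZ
    obtain ⟨l, hl⟩ := Module.projective_lifting_property g q hg
    refine ⟨a + b, (LinearMap.coprod (f ∘ₗ p) l) ∘ₗ (finAddEquiv A a b).toLinearMap,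
      Function.Surjective.comp (g := LinearMap.coprod (f ∘ₗ p) l) (fun y => ?_)
        (finAddEquiv A a b).surjective⟩
    obtain ⟨v, hv⟩ := hq (g y)
    obtain ⟨x, hx⟩ := (hfg (y - l v)).1 (by
      rw [map_sub, ← hv, ← hl, LinearMap.comp_apply, sub_self])
    obtain ⟨w, rfl⟩ := hp x
    exact ⟨(w, v), by simp [hx]⟩
  | succ n ih =>
    obtain ⟨a, p, hp, hpk⟩ := hX
    obtain ⟨b, q, hq, hqk⟩ := hZ
    obtain ⟨l, hl⟩ := Module.projective_lifting_property g q hg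
    have hgl : ∀ v, g (l v) = q v := fun v => congrArg (fun t => t v) hl
    have hgf : ∀ v, g (f v) = 0 := fun v => (hfg _).2 ⟨v, rfl⟩
    have hsurj : Function.Surjective (LinearMap.coprod (f ∘ₗ p) l) := fun y => by
      obtain ⟨v, hv⟩ := hq (g y)
      obtain ⟨x, hx⟩ := (hfg (y - l v)).1 (by rw [map_sub, ← hv, hgl, sub_self])
      obtain ⟨w, rfl⟩ := hp x
      exact ⟨(w, v), by simp [hx]⟩
    refine NPres.of_prod (LinearMap.coprod (f ∘ₗ p) l) hsurj ?_
    let i : LinearMap.ker p →ₗ[A] LinearMap.ker (LinearMap.coprod (f ∘ₗ p) l) :=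
      LinearMap.codRestrict _ (LinearMap.inl A _ _ ∘ₗ (LinearMap.ker p).subtype) fun v => by simp
    let s : LinearMap.ker (LinearMap.coprod (f ∘ₗ p) l) →ₗ[A] LinearMap.ker q :=
      LinearMap.codRestrict _ (LinearMap.snd A _ _ ∘ₗ Submodule.subtype _) fun v => by
        have h := v.2
        rw [LinearMap.mem_ker, LinearMap.coprod_apply] at h
        simpa [hgl, hgf] using congrArg g h
    refine ih (f := i) (g := s) (fun v w h => ?_) (fun v => ⟨fun h => ?_, ?_⟩) (fun v => ?_)
      hpk hqk
    · exact Subtype.ext (congrArg (fun t => t.1.1) h)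
    · have h2 : v.1.2 = 0 := congrArg Subtype.val h
      have h1 := v.2
      rw [LinearMap.mem_ker, LinearMap.coprod_apply, h2, map_zero, add_zero] at h1
      refine ⟨⟨v.1.1, hf (by simpa using h1)⟩, Subtype.ext (Prod.ext rfl h2.symm)⟩
    · rintro ⟨w, rfl⟩
      rfl
    · obtain ⟨x, hx⟩ := (hfg (l v)).1 (by rw [hgl]; exact v.2)
      obtain ⟨w, rfl⟩ := hp x
      exact ⟨⟨(-w, v), by simp [hx]⟩, rfl⟩

/-- The kernel of the composite cover A^r → Y → Z is an extension of ker g ≅ X by the kernel of A^r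
→ Y. -/
theorem NPres.cokernel {n : ℕ} {f : X →ₗ[A] Y} {g : Y →ₗ[A] Z} (hf : Function.Injective f)
    (hfg : Function.Exact f g) (hg : Function.Surjective g) (hX : NPres A n X)
    (hY : NPres A (n + 1) Y) : NPres A (n + 1) Z := by
  obtain ⟨r, p, hp, hpk⟩ := hY
  refine ⟨r, g ∘ₗ p, hg.comp hp, ?_⟩
  have hfg0 : ∀ x, g (f x) = 0 := fun x => (hfg _).2 ⟨x, rfl⟩
  let i : LinearMap.ker p →ₗ[A] LinearMap.ker (g ∘ₗ p) :=
    Submodule.inclusion (fun v hv => by simp_all)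
  let s : LinearMap.ker (g ∘ₗ p) →ₗ[A] LinearMap.ker g :=
    LinearMap.codRestrict _ (p ∘ₗ Submodule.subtype _) fun v => v.2
  refine NPres.extension (f := i) (g := s) (Submodule.inclusion_injective _)
    (fun v => ⟨fun h => ⟨⟨v.1, congrArg Subtype.val h⟩, rfl⟩, ?_⟩) (fun z => ?_) hpk
    (hX.congr (equivKer hf hfg))
  · rintro ⟨w, rfl⟩
    exact Subtype.ext w.2
  · obtain ⟨v, hv⟩ := hp z.1
    exact ⟨⟨v, by rw [LinearMap.mem_ker, LinearMap.comp_apply, hv]; exact z.2⟩, Subtype.ext hv⟩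

theorem NPres.pi {n : ℕ} (hX : NPres A n X) (q : ℕ) : NPres A n (Fin q → X) :=
  pow_induction (P := fun M _ _ => NPres A n M) (fun M _ _ _ => NPres.of_subsingleton n M)
    (fun _ _ _ _ _ _ _ _ _ _ _ hf hfg hg hM hL => NPres.extension hf hfg hg hM hL) hX q

theorem SuperFinitelyPresented.congr (e : X ≃ₗ[A] Y) (h : SuperFinitelyPresented A X) :
    SuperFinitelyPresented A Y := by
  obtain ⟨F⟩ := h
  exact ⟨⟨F.rank, e.toLinearMap ∘ₗ F.aug, F.diff, e.surjective.comp F.aug_surjective,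
    fun x => by simpa using F.exact_zero x, F.exact_succ⟩⟩

/-- The resolution of the zeroth syzygy obtained by truncation. -/
def FiniteFreeResolution.shift (F : FiniteFreeResolution A U) :
    FiniteFreeResolution A (LinearMap.ker F.aug) where
  rank i := F.rank (i + 1)
  aug := LinearMap.codRestrict _ (F.diff 0) fun x => (F.exact_zero _).2 ⟨x, rfl⟩
  diff i := F.diff (i + 1)
  aug_surjective := fun x => by
    obtain ⟨y, hy⟩ := (F.exact_zero x).1 x.2
    exact ⟨y, Subtype.ext hy⟩
  exact_zero := fun x => by
    rw [← F.exact_succ 0 x]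
    exact Subtype.ext_iff
  exact_succ i := F.exact_succ (i + 1)

/-- The zeroth syzygy of the truncated resolution is the first syzygy. -/
def FiniteFreeResolution.kerShiftAugEquiv (F : FiniteFreeResolution A U) :
    LinearMap.ker F.shift.aug ≃ₗ[A] LinearMap.ker (F.diff 0) :=
  let e := LinearEquiv.ofEq _ _ (LinearMap.ker_codRestrict (LinearMap.ker F.aug) (F.diff 0)
    fun x => (F.exact_zero _).2 ⟨x, rfl⟩)
  e

theorem SuperFinitelyPresented.exists_ker (h : SuperFinitelyPresented A U) :
    ∃ (r : ℕ) (f : (Fin r → A) →ₗ[A] U), Function.Surjective f ∧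
      SuperFinitelyPresented A (LinearMap.ker f) := by
  obtain ⟨F⟩ := h
  exact ⟨F.rank 0, F.aug, F.aug_surjective, ⟨F.shift⟩⟩

theorem SuperFinitelyPresented.nPres (h : SuperFinitelyPresented A U) (n : ℕ) : NPres A n U := by
  induction n generalizing U with
  | zero =>
    obtain ⟨r, f, hf, -⟩ := h.exists_ker
    exact ⟨r, f, hf⟩
  | succ n ih =>
    obtain ⟨r, f, hf, hk⟩ := h.exists_ker
    exact ⟨r, f, hf, ih hk⟩

variable {I : Type u} [AddCommGroup I] [Module A I]

/-- Each extra step of presentation of U buys one further degree: the kernel of a cover is presented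
one step less, and its Ext is shifted by one. -/
theorem IsNDInjective.extZero {n d : ℕ} (hI : IsNDInjective A n d I) (k : ℕ)
    (hU : NPres A (n + k) U) : ExtZero A U I (d + 1 + k) := by
  induction k generalizing U with
  | zero => exact hI U hU.finitelyNPresented
  | succ k ih =>
    obtain ⟨r, f, hf, hk⟩ := hU
    exact ExtZero.of_left_of_middle (i := d + 1 + k) (Submodule.subtype_injective _)
      (LinearMap.exact_subtype_ker_map f) hf (ih hk) (ExtZero.of_projective _)

theorem FiniteFreeResolution.superFinitelyPresented_syzygy (F : FiniteFreeResolution A U) (i : ℕ) :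
    SuperFinitelyPresented A (F.syzygy i) := by
  induction i generalizing U with
  | zero => exact ⟨F.shift⟩
  | succ i ih =>
    -- Syzygies of the truncated resolution agree definitionally with those of F only from index 1
    -- on; at index 0 the kernel of the corestricted map must be identified separately.
    cases i with
    | zero =>
      have : SuperFinitelyPresented A (LinearMap.ker F.shift.aug) := ih F.shift
      exact this.congr F.kerShiftAugEquiv
    | succ i => exact ih F.shift

/-- Dimension shifting down the resolution: the i-th syzygy sits i + 1 short exact sequences away
from U. -/
theorem FiniteFreeResolution.extZero_syzygy (F : FiniteFreeResolution A U) (i j : ℕ)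
    (h : ExtZero A U I (j + 1 + (i + 1))) : ExtZero A (F.syzygy i) I (j + 1) := by
  induction i generalizing U with
  | zero =>
    exact ExtZero.of_middle_of_right (Submodule.subtype_injective _)
      (LinearMap.exact_subtype_ker_map F.aug) F.aug_surjective (ExtZero.of_projective _) h
  | succ i ih =>
    have h' : ExtZero A (LinearMap.ker F.aug) I (j + 1 + (i + 1)) :=
      ExtZero.of_middle_of_right (Submodule.subtype_injective _)
        (LinearMap.exact_subtype_ker_map F.aug) F.aug_surjective
        (ExtZero.of_projective (j + 1 + i)) h
    cases i with
    | zero =>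
      have : ExtZero A (LinearMap.ker F.shift.aug) I (j + 1) := ih F.shift h'
      exact this.congr_left F.kerShiftAugEquiv
    | succ i => exact ih F.shift h'

theorem IsSyzygy.superFinitelyPresented {i : ℕ} (h : IsSyzygy A i U X) :
    SuperFinitelyPresented A X := by
  obtain ⟨F, ⟨e⟩⟩ := h
  exact (F.superFinitelyPresented_syzygy i).congr e.symm

/-- Passing from C to its (d-1)-th syzygy shifts degrees by d, so vanishing above degree d becomes
vanishing in all positive degrees. The subtraction d - 1 is genuine because d ≥ 1. -/
theorem IsNDInjective.extZero_of_isSyzygy {n d : ℕ} (hI : IsNDInjective A n d I) (hd : 1 ≤ d)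
    (h : IsSyzygy A (d - 1) U X) (j : ℕ) : ExtZero A X I (j + 1) := by
  obtain ⟨F, ⟨e⟩⟩ := h
  refine ExtZero.congr_left e.symm (F.extZero_syzygy (d - 1) j ?_)
  have := hI.extZero j (SuperFinitelyPresented.nPres ⟨F⟩ (n + j))
  rwa [show j + 1 + (d - 1 + 1) = d + 1 + j by omega]

end Presentations

/-! ### Duality with respect to K -/

section Duality

theorem NPres.of_succ {A : Type u} [Ring A] {U : Type u} [AddCommGroup U] [Module A U] {n : ℕ}
    (h : NPres A (n + 1) U) : NPres A n U := by
  induction n generalizing U with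
  | zero =>
    obtain ⟨r, f, hf, -⟩ := h
    exact ⟨r, f, hf⟩
  | succ n ih =>
    obtain ⟨r, f, hf, hk⟩ := h
    exact ⟨r, f, hf, ih hk⟩

variable {A B : Type u} [Ring A] [Ring B] {K : Type u} [AddCommGroup K] [Module A K] [Module B K]
  [SMulCommClass B A K] {X Y Z I : Type u} [AddCommGroup X] [Module B X] [AddCommGroup Y]
  [Module B Y] [AddCommGroup Z] [Module B Z] [AddCommGroup I] [Module A I]

variable (A B K X) in
/-- The `B`-module `X` has a resolution by finitely generated free modules, which stays exact under
`Hom_B(-, K)`, and the `A`-module `Hom_B(X, K)` is finitely `n`-presented for all `n`. -/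
structure DualFinite : Prop where
  super : SuperFinitelyPresented B X
  ext : ∀ j, ExtZero B X K (j + 1)
  nPres : ∀ n, NPres A n (X →ₗ[B] K)

theorem lcomp_injective {g : Y →ₗ[B] Z} (hg : Function.Surjective g) :
    Function.Injective (LinearMap.lcomp A K g) := fun φ ψ h =>
  LinearMap.ext fun z => by
    obtain ⟨y, rfl⟩ := hg z
    exact congrArg (fun t : Y →ₗ[B] K => t y) h

theorem lcomp_exact {f : X →ₗ[B] Y} {g : Y →ₗ[B] Z} (hfg : Function.Exact f g)
    (hg : Function.Surjective g) :
    Function.Exact (LinearMap.lcomp A K g) (LinearMap.lcomp A K f) := by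
  intro φ
  constructor
  · intro h
    have hk : LinearMap.ker g ≤ LinearMap.ker φ := by
      intro y hy
      obtain ⟨x, rfl⟩ := (hfg y).1 hy
      exact congrArg (fun t : X →ₗ[B] K => t x) h
    refine ⟨(LinearMap.ker g).liftQ φ hk ∘ₗ (g.quotKerEquivOfSurjective hg).symm.toLinearMap, ?_⟩
    ext y
    have : (g.quotKerEquivOfSurjective hg).symm (g y) = (LinearMap.ker g).mkQ y := by
      rw [LinearEquiv.symm_apply_eq]; rfl
    simp [this]
  · rintro ⟨ψ, rfl⟩
    ext x
    simp [(hfg (f x)).2 ⟨x, rfl⟩]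

theorem lcomp_surjective {f : X →ₗ[B] Y} {g : Y →ₗ[B] Z} (hf : Function.Injective f)
    (hfg : Function.Exact f g) (hg : Function.Surjective g) (hZ : ExtZero B Z K 1) :
    Function.Surjective (LinearMap.lcomp A K f) := fun φ =>
  hZ.exists_extension hf hfg hg φ

variable (A B K) in
/-- `Hom_B(B^r, K) ≅ K^r`. -/
def homFreeEquiv (r : ℕ) : (Fin r → K) ≃ₗ[A] ((Fin r → B) →ₗ[B] K) :=
  (Pi.basisFun B (Fin r)).constr A

theorem homFreeEquiv_apply {r : ℕ} (w : Fin r → K) (i : Fin r) :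
    homFreeEquiv A B K r w (Pi.single i 1) = w i := by
  have := (Pi.basisFun B (Fin r)).constr_basis A w i
  rwa [Pi.basisFun_apply] at this

/-- The homothety isomorphism `A ≅ Hom_B(K, K)`. -/
def homothetyEquiv [SMulCommClass A B K]
    (h : Function.Bijective fun a : A => (DistribSMul.toLinearMap B K a : K →ₗ[B] K)) :
    A ≃ₗ[A] (K →ₗ[B] K) :=
  LinearEquiv.ofBijective
    { toFun := fun a => (DistribSMul.toLinearMap B K a : K →ₗ[B] K)
      map_add' := fun a b => LinearMap.ext fun k => add_smul a b k
      map_smul' := fun a b => LinearMap.ext fun k => mul_smul a b k } h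

/-- The dual of K is the base ring A by the homothety isomorphism, so it is free of rank one. -/
theorem DualFinite.self [SMulCommClass A B K]
    (h : Function.Bijective fun a : A => (DistribSMul.toLinearMap B K a : K →ₗ[B] K))
    (hK : SuperFinitelyPresented B K) (hext : ∀ j, ExtZero B K K (j + 1)) : DualFinite A B K K :=
  ⟨hK, hext, fun n => (NPres.self n).congr (homothetyEquiv h)⟩

/-- Closure under syzygies. As Ext^1(X,K) = 0, the dual sequence 0 → X* → K^r → (ker f)* → 0 is
exact, and it presents (ker f)* as a cokernel of modules finitely presented to all orders. -/
theorem DualFinite.exists_ker (hK : ∀ n, NPres A n K) (hX : DualFinite A B K X) :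
    ∃ (r : ℕ) (f : (Fin r → B) →ₗ[B] X), Function.Surjective f ∧
      DualFinite A B K (LinearMap.ker f) := by
  obtain ⟨r, f, hf, hk⟩ := hX.super.exists_ker
  refine ⟨r, f, hf, hk, fun j => ?_, fun n => ?_⟩
  · exact ExtZero.of_middle_of_right (Submodule.subtype_injective _)
      (LinearMap.exact_subtype_ker_map f) hf (ExtZero.of_projective j) (hX.ext (j + 1))
  · exact NPres.of_succ (NPres.cokernel (lcomp_injective hf)
      (lcomp_exact (LinearMap.exact_subtype_ker_map f) hf)
      (lcomp_surjective (Submodule.subtype_injective _)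
      (LinearMap.exact_subtype_ker_map f) hf (hX.ext 0)) (hX.nPres n)
      (((hK (n + 1)).pi r).congr (homFreeEquiv A B K r)))

variable (A K I) in
/-- `Ext_A^j(K, I) = 0` for `j ≥ 1`, and `Ext_A^j(U, I) = 0` for large `j` if the `A`-module `U` is
finitely `n`-presented for all `n`. -/
structure ExtAcyclic (d : ℕ) : Prop where
  ext : ∀ j, ExtZero A K I (j + 1)
  ext_of_nPres : ∀ (U : Type u) [AddCommGroup U] [Module A U], (∀ n, NPres A n U) →
    ∀ j, ExtZero A U I (d + 1 + j)

theorem IsNDInjective.extAcyclic {C : Type u} [AddCommGroup C] [Module A C] {n d : ℕ}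
    (hI : IsNDInjective A n d I) (hd : 1 ≤ d) (h : IsSyzygy A (d - 1) C K) :
    ExtAcyclic A K I d :=
  ⟨hI.extZero_of_isSyzygy hd h, fun _ _ _ hU j => hI.extZero j (hU (n + j))⟩

/-- In 0 → X* → K^r → (ker f)* → 0 the middle term is acyclic, so replacing X by its syzygy raises
the degree to be killed by one. Beyond degree d the finiteness of the dual suffices. -/
theorem DualFinite.extZero {d : ℕ} (hK : ∀ n, NPres A n K) (hI : ExtAcyclic A K I d)
    (hX : DualFinite A B K X) (j : ℕ) : ExtZero A (X →ₗ[B] K) I (j + 1) := by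
  -- Here k bounds the number of syzygies still needed to reach degree d + 1; X varies in the
  -- induction.
  suffices ∀ (k : ℕ) (X : Type u) [AddCommGroup X] [Module B X], DualFinite A B K X →
      ∀ j, d + 1 ≤ j + 1 + k → ExtZero A (X →ₗ[B] K) I (j + 1) from
    this (d + 1) X hX j (by omega)
  intro k
  induction k with
  | zero =>
    intro X _ _ hX j hj
    have := hI.ext_of_nPres _ hX.nPres (j - d)
    rwa [show d + 1 + (j - d) = j + 1 by omega] at this
  | succ k ih =>
    intro X _ _ hX j hj
    obtain ⟨r, f, hf, hk⟩ := hX.exists_ker hK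
    exact ExtZero.of_middle_of_right (lcomp_injective hf)
      (lcomp_exact (LinearMap.exact_subtype_ker_map f) hf)
      (lcomp_surjective (Submodule.subtype_injective _)
      (LinearMap.exact_subtype_ker_map f) hf (hX.ext 0))
      (((hI.ext j).pi r).congr_left (homFreeEquiv A B K r)) (ih _ hk (j + 1) (by omega))

/-- The cokernel of X* → (B^r)* is (ker f)*, and Ext^1 of it into I vanishes. -/
theorem DualFinite.exists_extension {d r : ℕ} (hK : ∀ n, NPres A n K) (hI : ExtAcyclic A K I d)
    (hX : DualFinite A B K X) {f : (Fin r → B) →ₗ[B] X} (hf : Function.Surjective f)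
    (hk : DualFinite A B K (LinearMap.ker f)) (h : (X →ₗ[B] K) →ₗ[A] I) :
    ∃ h' : ((Fin r → B) →ₗ[B] K) →ₗ[A] I, h' ∘ₗ LinearMap.lcomp A K f = h :=
  (hk.extZero hK hI 0).exists_extension (lcomp_injective hf)
      (lcomp_exact (LinearMap.exact_subtype_ker_map f) hf)
      (lcomp_surjective (Submodule.subtype_injective _)
      (LinearMap.exact_subtype_ker_map f) hf (hX.ext 0)) h

end Duality

/-! ### Balanced tensor products: right exactness and free modules -/

section BalancedTensor

/-- `U ⊗_R N` for a right `R`-module `U` and a left `R`-module `N`, an abelian group. -/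
abbrev BTensor (R U N : Type u) [Ring R] [AddCommGroup U] [Module Rᵐᵒᵖ U] [AddCommGroup N]
    [Module R N] : Type u :=
  (U ⊗[ℤ] N) ⧸ torRel R U N

variable {R : Type u} [Ring R] {U V X Y Z : Type u} [AddCommGroup U] [Module Rᵐᵒᵖ U]
  [AddCommGroup V] [Module Rᵐᵒᵖ V] [AddCommGroup X] [Module Rᵐᵒᵖ X] [AddCommGroup Y]
  [Module Rᵐᵒᵖ Y] [AddCommGroup Z] [Module Rᵐᵒᵖ Z] {M N L F : Type u} [AddCommGroup M] [Module R M]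
  [AddCommGroup N] [Module R N] [AddCommGroup L] [Module R L] [AddCommGroup F] [Module R F]

variable (R) in
/-- The class of `u ⊗ x` in `U ⊗_R N`. -/
def btmul (u : U) (x : N) : BTensor R U N := (torRel R U N).mkQ (u ⊗ₜ[ℤ] x)

theorem btmul_add (u : U) (x y : N) : btmul R u (x + y) = btmul R u x + btmul R u y := by
  simp only [btmul, TensorProduct.tmul_add, map_add]

theorem add_btmul (u v : U) (x : N) : btmul R (u + v) x = btmul R u x + btmul R v x := by
  simp only [btmul, TensorProduct.add_tmul, map_add]

theorem smul_btmul (r : R) (u : U) (x : N) : btmul R (op r • u) x = btmul R u (r • x) := by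
  refine (Submodule.Quotient.eq _).2 (Submodule.subset_span ⟨u, r, x, rfl⟩)

theorem btmul_zero (u : U) : btmul R u (0 : N) = 0 := by
  simp only [btmul, TensorProduct.tmul_zero, map_zero]

theorem zero_btmul (x : N) : btmul R (0 : U) x = 0 := by
  simp only [btmul, TensorProduct.zero_tmul, map_zero]

theorem sum_btmul {ι : Type*} (s : Finset ι) (u : ι → U) (x : N) :
    btmul R (∑ j ∈ s, u j) x = ∑ j ∈ s, btmul R (u j) x := by
  simp only [btmul, TensorProduct.sum_tmul, map_sum]

theorem BTensor.induction {motive : BTensor R U N → Prop} (tmul : ∀ u x, motive (btmul R u x))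
    (add : ∀ s t, motive s → motive t → motive (s + t)) (t : BTensor R U N) : motive t := by
  obtain ⟨t, rfl⟩ := (torRel R U N).mkQ_surjective t
  induction t using TensorProduct.induction_on with
  | zero => simpa only [btmul, TensorProduct.tmul_zero] using tmul 0 0
  | tmul u x => exact tmul u x
  | add s t hs ht => rw [map_add]; exact add _ _ hs ht

/-- The additive map on `U ⊗_R N` given by a balanced biadditive map. -/
def BTensor.lift {W : Type*} [AddCommGroup W] (φ : U →+ N →+ W)
    (hφ : ∀ (r : R) u x, φ (op r • u) x = φ u (r • x)) : BTensor R U N →ₗ[ℤ] W :=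
  (torRel R U N).liftQ (TensorProduct.liftAddHom φ fun z u x => by
    rw [map_zsmul, map_zsmul]; rfl).toIntLinearMap <| by
      refine Submodule.span_le.2 ?_
      rintro _ ⟨k, r, x, rfl⟩
      simp [hφ]

theorem tensorMap_btmul (g : U →ₗ[Rᵐᵒᵖ] V) (u : U) (x : N) :
    tensorMap R N g (btmul R u x) = btmul R (g u) x := rfl

theorem torRel_le_comap_right (h : M →ₗ[R] N) :
    torRel R U M ≤ (torRel R U N).comap
      (TensorProduct.map (LinearMap.id : U →ₗ[ℤ] U) h.toAddMonoidHom.toIntLinearMap) := by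
  refine Submodule.span_le.2 ?_
  rintro _ ⟨k, r, x, rfl⟩
  refine Submodule.subset_span ⟨k, r, h x, ?_⟩
  simp

variable (U) in
/-- The map `U ⊗_R M → U ⊗_R N` induced by a map `M → N` of left `R`-modules. -/
def tensorMapRight (h : M →ₗ[R] N) : BTensor R U M →ₗ[ℤ] BTensor R U N :=
  (torRel R U M).mapQ (torRel R U N) _ (torRel_le_comap_right h)

theorem tensorMapRight_btmul (h : M →ₗ[R] N) (u : U) (x : M) :
    tensorMapRight U h (btmul R u x) = btmul R u (h x) := rfl

theorem tensorMap_tensorMapRight (g : U →ₗ[Rᵐᵒᵖ] V) (h : M →ₗ[R] N) (t : BTensor R U M) :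
    tensorMap R N g (tensorMapRight U h t) = tensorMapRight V h (tensorMap R M g t) := by
  induction t using BTensor.induction with
  | tmul u x => rfl
  | add s t hs ht => simp only [map_add, hs, ht]

/-- By `hs`, a relation met by g t lifts to a relation in H; subtracting it moves t into ker g
without changing its class. -/
theorem mapQ_exact {G H J : Type*} [AddCommGroup G] [AddCommGroup H] [AddCommGroup J]
    {p : Submodule ℤ G} {q : Submodule ℤ H} {s : Submodule ℤ J} {f : G →ₗ[ℤ] H} {g : H →ₗ[ℤ] J}
    (hf : p ≤ q.comap f) (hg : q ≤ s.comap g) (hs : s ≤ q.map g) (hfg : Function.Exact f g) :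
    Function.Exact (p.mapQ q f hf) (q.mapQ s g hg) := by
  intro t
  obtain ⟨t, rfl⟩ := q.mkQ_surjective t
  constructor
  · intro h
    have h' : g t ∈ s := (Submodule.Quotient.mk_eq_zero s).1 h
    obtain ⟨y, hy, hyt⟩ := hs h'
    obtain ⟨x, hx⟩ := (hfg (t - y)).1 (by rw [map_sub, hyt, sub_self])
    refine ⟨p.mkQ x, (Submodule.Quotient.eq q).2 ?_⟩
    rw [hx, sub_sub_cancel_left]
    exact q.neg_mem hy
  · rintro ⟨x, hx⟩
    obtain ⟨x, rfl⟩ := p.mkQ_surjective x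
    rw [← hx]
    change s.mkQ (g (f x)) = 0
    rw [(hfg _).2 ⟨x, rfl⟩, map_zero]

theorem tensorMap_surjective {g : Y →ₗ[Rᵐᵒᵖ] Z} (hg : Function.Surjective g) :
    Function.Surjective (tensorMap R N g) := fun t => by
  induction t using BTensor.induction with
  | tmul u x =>
    obtain ⟨v, rfl⟩ := hg u
    exact ⟨btmul R v x, rfl⟩
  | add s t hs ht =>
    obtain ⟨s, rfl⟩ := hs
    obtain ⟨t, rfl⟩ := ht
    exact ⟨s + t, map_add _ _ _⟩

theorem tensorMapRight_surjective {g : N →ₗ[R] L} (hg : Function.Surjective g) :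
    Function.Surjective (tensorMapRight U g) := fun t => by
  induction t using BTensor.induction with
  | tmul u x =>
    obtain ⟨v, rfl⟩ := hg x
    exact ⟨btmul R u v, rfl⟩
  | add s t hs ht =>
    obtain ⟨s, rfl⟩ := hs
    obtain ⟨t, rfl⟩ := ht
    exact ⟨s + t, map_add _ _ _⟩

theorem tensorMap_exact {f : X →ₗ[Rᵐᵒᵖ] Y} {g : Y →ₗ[Rᵐᵒᵖ] Z} (hfg : Function.Exact f g)
    (hg : Function.Surjective g) : Function.Exact (tensorMap R N f) (tensorMap R N g) := by
  refine mapQ_exact _ _ (Submodule.span_le.2 ?_)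
    (rTensor_exact N (f := f.toAddMonoidHom.toIntLinearMap) (g := g.toAddMonoidHom.toIntLinearMap)
      hfg hg)
  rintro _ ⟨k, r, x, rfl⟩
  obtain ⟨k, rfl⟩ := hg k
  have : TensorProduct.map g.toAddMonoidHom.toIntLinearMap (LinearMap.id : N →ₗ[ℤ] N)
      ((op r • k) ⊗ₜ[ℤ] x - k ⊗ₜ[ℤ] (r • x)) =
      (op r • g k) ⊗ₜ[ℤ] x - g k ⊗ₜ[ℤ] (r • x) := by simp
  exact ⟨_, Submodule.subset_span ⟨k, r, x, rfl⟩, this⟩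

theorem tensorMapRight_exact {f : M →ₗ[R] N} {g : N →ₗ[R] L} (hfg : Function.Exact f g)
    (hg : Function.Surjective g) :
    Function.Exact (tensorMapRight U f) (tensorMapRight U g) := by
  refine mapQ_exact _ _ (Submodule.span_le.2 ?_)
    (lTensor_exact U (f := f.toAddMonoidHom.toIntLinearMap) (g := g.toAddMonoidHom.toIntLinearMap)
      hfg hg)
  rintro _ ⟨k, r, x, rfl⟩
  obtain ⟨x, rfl⟩ := hg x
  have : TensorProduct.map (LinearMap.id : U →ₗ[ℤ] U) g.toAddMonoidHom.toIntLinearMap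
      ((op r • k) ⊗ₜ[ℤ] x - k ⊗ₜ[ℤ] (r • x)) =
      (op r • k) ⊗ₜ[ℤ] g x - k ⊗ₜ[ℤ] (r • g x) := by simp
  exact ⟨_, Submodule.subset_span ⟨k, r, x, rfl⟩, this⟩

variable (R N) in
/-- `R^r ⊗_R N → N^r`. -/
def freeTensorTo (r : ℕ) : BTensor R (Fin r → Rᵐᵒᵖ) N →ₗ[ℤ] (Fin r → N) :=
  BTensor.lift
    (AddMonoidHom.mk' (fun v => AddMonoidHom.mk' (fun x j => unop (v j) • x)
      fun x y => by ext j; simp [smul_add]) fun v w => by ext x j; simp [add_smul])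
    fun r v x => by ext j; simp [mul_smul]

theorem freeTensorTo_btmul {r : ℕ} (v : Fin r → Rᵐᵒᵖ) (x : N) (j : Fin r) :
    freeTensorTo R N r (btmul R v x) j = unop (v j) • x := rfl

theorem sum_btmul_freeTensorTo {r : ℕ} (t : BTensor R (Fin r → Rᵐᵒᵖ) N) :
    ∑ j, btmul R (Pi.single j (1 : Rᵐᵒᵖ)) (freeTensorTo R N r t j) = t := by
  induction t using BTensor.induction with
  | tmul v x =>
    simp only [freeTensorTo_btmul, ← smul_btmul, op_unop]
    rw [← sum_btmul]
    congr 1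
    ext j
    simp [Finset.sum_apply, Pi.single_apply]
  | add s t hs ht =>
    rw [map_add]
    simp only [Pi.add_apply, btmul_add, Finset.sum_add_distrib, hs, ht]

theorem freeTensorTo_injective (r : ℕ) : Function.Injective (freeTensorTo R N r) := fun s t h => by
  rw [← sum_btmul_freeTensorTo s, h, sum_btmul_freeTensorTo]

/-- Flatness of finitely generated free modules: under `freeTensorTo` the induced map acts as f on
each coordinate. -/
theorem tensorMapRight_free_injective (r : ℕ) {f : M →ₗ[R] N} (hf : Function.Injective f) :
    Function.Injective (tensorMapRight (Fin r → Rᵐᵒᵖ) f) := by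
  have key : ∀ t j, freeTensorTo R N r (tensorMapRight (Fin r → Rᵐᵒᵖ) f t) j =
      f (freeTensorTo R M r t j) := fun t j => by
    induction t using BTensor.induction with
    | tmul v x =>
      rw [tensorMapRight_btmul, freeTensorTo_btmul, freeTensorTo_btmul, map_smul]
    | add s t hs ht => simp only [map_add, Pi.add_apply, hs, ht]
  intro s t h
  refine freeTensorTo_injective r (funext fun j => hf ?_)
  rw [← key, ← key, h]

end BalancedTensor

/-! ### Character modules and tensor-hom adjunction -/

section CharacterDual

/-- The character module `Hom_ℤ(F, ℚ/ℤ)` of a left `R`-module `F`, a right `R`-module. -/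
def CharDual (F : Type u) [AddCommGroup F] : Type u := F →+ AddCircle (1 : ℚ)

instance (F : Type u) [AddCommGroup F] : AddCommGroup (CharDual F) :=
  inferInstanceAs (AddCommGroup (F →+ AddCircle (1 : ℚ)))

instance (F : Type u) [AddCommGroup F] : FunLike (CharDual F) F (AddCircle (1 : ℚ)) :=
  inferInstanceAs (FunLike (F →+ AddCircle (1 : ℚ)) F (AddCircle (1 : ℚ)))

instance (F : Type u) [AddCommGroup F] : AddMonoidHomClass (CharDual F) F (AddCircle (1 : ℚ)) :=
  inferInstanceAs (AddMonoidHomClass (F →+ AddCircle (1 : ℚ)) F (AddCircle (1 : ℚ)))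

theorem CharDual.ext {F : Type u} [AddCommGroup F] {c c' : CharDual F} (h : ∀ x, c x = c' x) :
    c = c' := DFunLike.ext _ _ h

theorem CharDual.add_apply {F : Type u} [AddCommGroup F] (c c' : CharDual F) (x : F) :
    (c + c') x = c x + c' x := rfl

theorem CharDual.zero_apply {F : Type u} [AddCommGroup F] (x : F) : (0 : CharDual F) x = 0 := rfl

variable {R : Type u} [Ring R] {M N L F : Type u} [AddCommGroup M] [Module R M]
  [AddCommGroup N] [Module R N] [AddCommGroup L] [Module R L] [AddCommGroup F] [Module R F]

instance : SMul Rᵐᵒᵖ (CharDual F) where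
  smul r c := (c : F →+ AddCircle (1 : ℚ)).comp (DistribSMul.toAddMonoidHom F (unop r))

theorem CharDual.smul_apply (r : Rᵐᵒᵖ) (c : CharDual F) (x : F) : (r • c) x = c (unop r • x) := rfl

instance : Module Rᵐᵒᵖ (CharDual F) where
  one_smul c := CharDual.ext fun x => by rw [CharDual.smul_apply, unop_one, one_smul]
  mul_smul a b c := CharDual.ext fun x => by
    simp only [CharDual.smul_apply, unop_mul, mul_smul]
  smul_zero r := rfl
  smul_add r c c' := rfl
  add_smul a b c := CharDual.ext fun x => by
    simp only [CharDual.smul_apply, CharDual.add_apply, MulOpposite.unop_add, add_smul, map_add]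
  zero_smul c := CharDual.ext fun x => by
    simp only [CharDual.smul_apply, CharDual.zero_apply, unop_zero, zero_smul, map_zero]

/-- The transpose of a map of left `R`-modules. -/
def charDualMap (f : M →ₗ[R] N) : CharDual N →ₗ[Rᵐᵒᵖ] CharDual M where
  toFun c := (c : N →+ AddCircle (1 : ℚ)).comp f.toAddMonoidHom
  map_add' _ _ := rfl
  map_smul' r c := CharDual.ext fun x => (congrArg c (f.map_smul (unop r) x)).symm

theorem charDualMap_apply (f : M →ₗ[R] N) (c : CharDual N) (x : M) :
    charDualMap f c x = c (f x) := rfl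

theorem exists_character_comp {G H : Type*} [AddCommGroup G] [AddCommGroup H] {f : G →+ H}
    (hf : Function.Injective f) (c : G →+ AddCircle (1 : ℚ)) :
    ∃ c' : H →+ AddCircle (1 : ℚ), c'.comp f = c :=
  CharacterModule.dual_surjective_of_injective f.toIntLinearMap hf c

theorem eq_zero_of_forall_character {G : Type*} [AddCommGroup G] {x : G}
    (h : ∀ c : G →+ AddCircle (1 : ℚ), c x = 0) : x = 0 :=
  CharacterModule.eq_zero_of_character_apply h

/-- A complex of abelian groups is exact iff its dual is. -/
theorem exact_iff_character {G H J : Type*} [AddCommGroup G] [AddCommGroup H] [AddCommGroup J]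
    {f : G →ₗ[ℤ] H} {g : H →ₗ[ℤ] J} (hfg : ∀ x, g (f x) = 0) :
    Function.Exact f g ↔ ∀ c : H →+ AddCircle (1 : ℚ), (∀ x, c (f x) = 0) →
      ∃ c' : J →+ AddCircle (1 : ℚ), ∀ y, c' (g y) = c y := by
  constructor
  · intro h c hc
    let c₀ : (H ⧸ LinearMap.ker g) →ₗ[ℤ] AddCircle (1 : ℚ) :=
      (LinearMap.ker g).liftQ c.toIntLinearMap fun y hy => by
        obtain ⟨x, rfl⟩ := (h y).1 hy
        exact hc x
    -- H/ker g embeds in J, so divisibility of ℚ/ℤ extends the induced character.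
    let i : (H ⧸ LinearMap.ker g) →ₗ[ℤ] J := (LinearMap.ker g).liftQ g le_rfl
    obtain ⟨c', hc'⟩ := exists_character_comp (f := i.toAddMonoidHom)
      (LinearMap.ker_eq_bot.1 (Submodule.ker_liftQ_eq_bot' _ _ rfl)) c₀.toAddMonoidHom
    exact ⟨c', fun y => congrArg (fun t => t ((LinearMap.ker g).mkQ y)) hc'⟩
  · intro h y
    refine ⟨fun hy => ?_, ?_⟩
    -- Characters separate the points of H/range f, and each of them factors through g.
    · have : (LinearMap.range f).mkQ y = 0 := eq_zero_of_forall_character fun c => by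
        obtain ⟨c', hc'⟩ := h (c.comp (LinearMap.range f).mkQ.toAddMonoidHom) fun x => by
          have hx : (LinearMap.range f).mkQ (f x) = 0 :=
            (Submodule.Quotient.mk_eq_zero _).2 ⟨x, rfl⟩
          exact (congrArg c hx).trans (map_zero c)
        have := hc' y
        rw [hy, map_zero] at this
        exact this.symm
      exact (Submodule.Quotient.mk_eq_zero _).1 this
    · rintro ⟨x, rfl⟩
      exact hfg x

theorem charDualMap_injective {g : N →ₗ[R] L} (hg : Function.Surjective g) :
    Function.Injective (charDualMap g) := fun c c' h => CharDual.ext fun x => by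
  obtain ⟨y, rfl⟩ := hg x
  exact congrArg (fun t : CharDual N => t y) h

theorem charDualMap_surjective {f : M →ₗ[R] N} (hf : Function.Injective f) :
    Function.Surjective (charDualMap f) :=
  exists_character_comp (f := f.toAddMonoidHom) hf

theorem charDualMap_exact {f : M →ₗ[R] N} {g : N →ₗ[R] L} (hfg : Function.Exact f g) :
    Function.Exact (charDualMap g) (charDualMap f) := by
  intro c
  constructor
  · intro h
    obtain ⟨c', hc'⟩ := (exact_iff_character (f := f.toAddMonoidHom.toIntLinearMap)
      (g := g.toAddMonoidHom.toIntLinearMap) (fun x => (hfg _).2 ⟨x, rfl⟩)).1 hfg c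
      (fun x => congrArg (fun t : CharDual M => t x) h)
    exact ⟨c', CharDual.ext hc'⟩
  · rintro ⟨c, rfl⟩
    refine CharDual.ext fun x => ?_
    rw [charDualMap_apply, charDualMap_apply, (hfg _).2 ⟨x, rfl⟩, map_zero]
    rfl

variable {U V : Type u} [AddCommGroup U] [Module Rᵐᵒᵖ U] [AddCommGroup V] [Module Rᵐᵒᵖ V]

/-- `Hom_ℤ(U ⊗_R F, ℚ/ℤ) → Hom_R(U, Hom_ℤ(F, ℚ/ℤ))`. -/
def charCurry (c : BTensor R U F →+ AddCircle (1 : ℚ)) : U →ₗ[Rᵐᵒᵖ] CharDual F where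
  toFun u := AddMonoidHom.mk' (fun x => c (btmul R u x)) fun x y => by rw [btmul_add, map_add]
  map_add' u v := CharDual.ext fun x => (congrArg c (add_btmul u v x)).trans (map_add c _ _)
  map_smul' r u := CharDual.ext fun x => congrArg c (smul_btmul (unop r) u x)

/-- `Hom_R(U, Hom_ℤ(F, ℚ/ℤ)) → Hom_ℤ(U ⊗_R F, ℚ/ℤ)`. -/
def charUncurry (h : U →ₗ[Rᵐᵒᵖ] CharDual F) : BTensor R U F →+ AddCircle (1 : ℚ) :=
  (BTensor.lift (AddMonoidHom.mk' (fun u => (h u : F →+ AddCircle (1 : ℚ))) h.map_add)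
    fun r u x => congrArg (fun t : CharDual F => t x) (h.map_smul (op r) u)).toAddMonoidHom

theorem character_hom_ext {c c' : BTensor R U F →+ AddCircle (1 : ℚ)}
    (h : ∀ u x, c (btmul R u x) = c' (btmul R u x)) (t : BTensor R U F) : c t = c' t := by
  induction t using BTensor.induction with
  | tmul u x => exact h u x
  | add s t hs ht => rw [map_add, map_add, hs, ht]

/-- `- ⊗_R F` preserves the injectivity of a map if every map to the character module of `F` extends
along it. -/
theorem tensorMap_injective_of_extension {i : U →ₗ[Rᵐᵒᵖ] V}
    (hi : ∀ h : U →ₗ[Rᵐᵒᵖ] CharDual F, ∃ h' : V →ₗ[Rᵐᵒᵖ] CharDual F, h' ∘ₗ i = h) :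
    Function.Injective (tensorMap R F i) := by
  refine (injective_iff_map_eq_zero _).2 fun t ht => eq_zero_of_forall_character fun c => ?_
  obtain ⟨h', hh⟩ := hi (charCurry c)
  have : ∀ t, c t = ((charUncurry h').comp (tensorMap R F i).toAddMonoidHom) t :=
    character_hom_ext fun u x => by
      change charCurry c u x = h' (i u) x
      rw [← hh]; rfl
  rw [this]
  change charUncurry h' (tensorMap R F i t) = 0
  rw [ht, map_zero]

end CharacterDual

/-! ### Tor against Ext into the character module -/

section Tor

variable {R : Type u} [Ring R] {F : Type u} [AddCommGroup F] [Module R F]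

theorem subsingleton_torMod_iff_exact {U : Type u} [AddCommGroup U] [Module Rᵐᵒᵖ U]
    (P : ProjectiveResolution (ModuleCat.of Rᵐᵒᵖ U)) (i : ℕ) :
    Subsingleton (TorMod R (i + 1) U F) ↔
      Function.Exact (tensorMap R F (P.complex.d (i + 2) (i + 1)).hom)
        (tensorMap R F (P.complex.d (i + 1) i).hom) := by
  have e := P.isoLeftDerivedObj (tensorFunctor R F) (i + 1)
  rw [← ModuleCat.isZero_iff_subsingleton, TorMod, e.isZero_iff]
  refine Iff.trans (HomologicalComplex.exactAt_iff_isZero_homology _ _).symm ?_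
  rw [HomologicalComplex.exactAt_iff' _ (i + 2) (i + 1) i (by simp) (by simp)]
  exact ShortComplex.ShortExact.moduleCat_exact_iff_function_exact _

theorem extZero_iff_exact {U : Type u} [AddCommGroup U] [Module Rᵐᵒᵖ U]
    (P : ProjectiveResolution (ModuleCat.of Rᵐᵒᵖ U)) (i : ℕ) {I : Type u} [AddCommGroup I]
    [Module Rᵐᵒᵖ I] :
    ExtZero Rᵐᵒᵖ U I (i + 1) ↔ ∀ f : P.complex.X (i + 1) ⟶ ModuleCat.of Rᵐᵒᵖ I,
      P.complex.d (i + 2) (i + 1) ≫ f = 0 →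
        ∃ g : P.complex.X i ⟶ ModuleCat.of Rᵐᵒᵖ I, P.complex.d (i + 1) i ≫ g = f := by
  constructor
  · intro h f hf
    exact (P.extMk_eq_zero_iff f (i + 2) rfl hf i rfl).1 (Subsingleton.elim _ _)
  · intro h
    refine subsingleton_of_forall_eq 0 fun x => ?_
    obtain ⟨f, hf, rfl⟩ := P.extMk_surjective x (i + 2) rfl
    exact (P.extMk_eq_zero_iff f (i + 2) rfl hf i rfl).2 (h f hf)

/-- On a projective resolution P of U, adjunction identifies the character dual of P ⊗ F with Hom(P,
F⁺), where F⁺ is the character module. Character duality preserves and reflects exactness. -/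
theorem subsingleton_torMod_iff {U : Type u} [AddCommGroup U] [Module Rᵐᵒᵖ U] (i : ℕ) :
    Subsingleton (TorMod R (i + 1) U F) ↔ ExtZero Rᵐᵒᵖ U (CharDual F) (i + 1) := by
  let P := projectiveResolution (ModuleCat.of Rᵐᵒᵖ U)
  have hd : ∀ t, tensorMap R F (P.complex.d (i + 1) i).hom
      (tensorMap R F (P.complex.d (i + 2) (i + 1)).hom t) = 0 := fun t => by
    induction t using BTensor.induction with
    | tmul u x =>
      rw [tensorMap_btmul, tensorMap_btmul]
      have := congrArg (fun t => t.hom u) (P.complex.d_comp_d (i + 2) (i + 1) i)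
      exact (congrArg (fun t => btmul R t x) this).trans (zero_btmul x)
    | add s t hs ht => rw [map_add, map_add, hs, ht, add_zero]
  rw [subsingleton_torMod_iff_exact P, extZero_iff_exact P, exact_iff_character hd]
  constructor
  · intro h f hf
    obtain ⟨c, hc⟩ := h (charUncurry f.hom) (character_hom_ext
      (c := (charUncurry f.hom).comp (tensorMap R F _).toAddMonoidHom) (c' := 0) fun u x =>
      congrArg (fun t => (t.hom u : CharDual F) x) hf)
    exact ⟨ModuleCat.ofHom (charCurry c), ModuleCat.hom_ext (LinearMap.ext fun u =>
      CharDual.ext fun x => hc (btmul R u x))⟩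
  · intro h c hc
    obtain ⟨g, hg⟩ := h (ModuleCat.ofHom (charCurry c)) (ModuleCat.hom_ext (LinearMap.ext fun u =>
      CharDual.ext fun x => hc (btmul R u x)))
    exact ⟨charUncurry g.hom, character_hom_ext
      (c := (charUncurry g.hom).comp (tensorMap R F _).toAddMonoidHom) fun u x =>
      congrArg (fun t => (t.hom u : CharDual F) x) hg⟩

theorem isNDFlat_iff_charDual {n d : ℕ} :
    IsNDFlat R n d F ↔ IsNDInjective Rᵐᵒᵖ n d (CharDual F) :=
  ⟨fun h U _ _ hU => (subsingleton_torMod_iff d).1 (h U hU),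
    fun h U _ _ hU => (subsingleton_torMod_iff d).2 (h U hU)⟩

theorem IsNDInjective.extension {A : Type u} [Ring A] {M N L : Type u} [AddCommGroup M]
    [Module A M] [AddCommGroup N] [Module A N] [AddCommGroup L] [Module A L] {n d : ℕ}
    {f : M →ₗ[A] N} {g : N →ₗ[A] L} (hf : Function.Injective f) (hfg : Function.Exact f g)
    (hg : Function.Surjective g) (hM : IsNDInjective A n d M) (hL : IsNDInjective A n d L) :
    IsNDInjective A n d N := fun U _ _ hU =>
  ExtZero.target_of_left_of_right hf hfg hg (hM U hU) (hL U hU)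

theorem IsNDInjective.congr {A : Type u} [Ring A] {M N : Type u} [AddCommGroup M]
    [Module A M] [AddCommGroup N] [Module A N] {n d : ℕ} (e : M ≃ₗ[A] N)
    (hM : IsNDInjective A n d M) : IsNDInjective A n d N := fun U _ _ hU =>
  ExtZero.congr_right e (hM U hU)

/-- Dualising reverses the sequence and reduces to extensions of (n,d)-injective modules. -/
theorem IsNDFlat.extension {M N L : Type u} [AddCommGroup M]
    [Module R M] [AddCommGroup N] [Module R N] [AddCommGroup L] [Module R L] {n d : ℕ}
    {f : M →ₗ[R] N} {g : N →ₗ[R] L} (hf : Function.Injective f) (hfg : Function.Exact f g)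
    (hg : Function.Surjective g) (hM : IsNDFlat R n d M) (hL : IsNDFlat R n d L) :
    IsNDFlat R n d N := by
  rw [isNDFlat_iff_charDual] at hM hL ⊢
  exact hL.extension (charDualMap_injective hg) (charDualMap_exact hfg) (charDualMap_surjective hf)
    hM

end Tor

/-! ### The S-module structure on the tensor product -/

section TensorMod

variable {S R K : Type u} [Ring S] [Ring R] [AddCommGroup K] [Module S K] [Module Rᵐᵒᵖ K]
  [SMulCommClass S Rᵐᵒᵖ K] {F M N L : Type u} [AddCommGroup F] [Module R F] [AddCommGroup M]
  [Module R M] [AddCommGroup N] [Module R N] [AddCommGroup L] [Module R L]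

variable (S R) in
/-- The class of `k ⊗ x` in `K ⊗_R F`. -/
def tmod (k : K) (x : F) : TensorMod S R K F := (balancedRel S R K F).mkQ (k ⊗ₜ[ℤ] x)

theorem tmod_add (k : K) (x y : F) : tmod S R k (x + y) = tmod S R k x + tmod S R k y := by
  simp only [tmod, TensorProduct.tmul_add, map_add]

theorem add_tmod (k l : K) (x : F) : tmod S R (k + l) x = tmod S R k x + tmod S R l x := by
  simp only [tmod, TensorProduct.add_tmul, map_add]

theorem op_smul_tmod (r : R) (k : K) (x : F) : tmod S R (op r • k) x = tmod S R k (r • x) :=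
  (Submodule.Quotient.eq _).2 (Submodule.subset_span ⟨k, r, x, rfl⟩)

theorem TensorMod.induction {motive : TensorMod S R K F → Prop}
    (tmul : ∀ k x, motive (tmod S R k x))
    (add : ∀ s t, motive s → motive t → motive (s + t)) (t : TensorMod S R K F) : motive t := by
  obtain ⟨t, rfl⟩ := (balancedRel S R K F).mkQ_surjective t
  induction t using TensorProduct.induction_on with
  | zero => simpa only [tmod, TensorProduct.tmul_zero] using tmul 0 0
  | tmul u x => exact tmul u x
  | add s t hs ht => rw [map_add]; exact add _ _ hs ht

/-- The `S`-linear map on `K ⊗_R F` given by a balanced biadditive map, `S`-linear in the first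
variable. -/
def TensorMod.lift {W : Type*} [AddCommGroup W] [Module S W] (φ : K →+ F →+ W)
    (hs : ∀ (s : S) k x, φ (s • k) x = s • φ k x)
    (hφ : ∀ (r : R) k x, φ (op r • k) x = φ k (r • x)) : TensorMod S R K F →ₗ[S] W :=
  (balancedRel S R K F).liftQ
    { (TensorProduct.liftAddHom φ fun z u x => by rw [map_zsmul, map_zsmul]; rfl) with
      map_smul' := fun s t => by
        induction t using TensorProduct.induction_on with
        | zero => simp
        | tmul k x => exact hs s k x
        | add a b ha hb => rw [smul_add]; simp_all } <| by
      refine Submodule.span_le.2 ?_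
      rintro _ ⟨k, r, x, rfl⟩
      simp [hφ]

variable (S R K F) in
-- S maps each generating relation to another one, because the two actions on K commute. Hence the
-- S-span adds nothing, and results on `BTensor` transfer to `TensorMod`.
theorem balancedRel_restrictScalars : (balancedRel S R K F).restrictScalars ℤ = torRel R K F := by
  refine le_antisymm (fun t ht => ?_)
    (Submodule.span_le.2 fun t ht => Submodule.subset_span (R := S) ht)
  refine Submodule.span_induction (p := fun t _ => t ∈ torRel R K F)
    (fun t ht => Submodule.subset_span ht) (zero_mem _) (fun _ _ _ _ => add_mem) ?_
    ((Submodule.restrictScalars_mem ℤ _ t).1 ht)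
  intro s t _ ht
  refine Submodule.span_induction (p := fun t _ => s • t ∈ torRel R K F) ?_ ?_ ?_ ?_ ht
  · rintro _ ⟨k, r, x, rfl⟩
    refine Submodule.subset_span ⟨s • k, r, x, ?_⟩
    rw [smul_sub, TensorProduct.smul_tmul', TensorProduct.smul_tmul', smul_comm]
  · rw [smul_zero]; exact zero_mem _
  · intro a b _ _ ha hb
    rw [smul_add]; exact add_mem ha hb
  · intro z a _ ha
    rw [smul_comm]; exact Submodule.smul_mem _ z ha

variable (S R K F) in
/-- The underlying abelian group of the `S`-module `K ⊗_R F`. -/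
def bTensorEquiv : BTensor R K F ≃+ TensorMod S R K F :=
  QuotientAddGroup.quotientAddEquivOfEq
    (congrArg Submodule.toAddSubgroup (balancedRel_restrictScalars S R K F).symm)

theorem bTensorEquiv_btmul (k : K) (x : F) :
    bTensorEquiv S R K F (btmul R k x) = tmod S R k x := rfl

variable (S K) in
/-- The map `K ⊗_R M → K ⊗_R N` induced by a map `M → N`. -/
def tensorModMap (h : M →ₗ[R] N) : TensorMod S R K M →ₗ[S] TensorMod S R K N :=
  TensorMod.lift
    (AddMonoidHom.mk' (fun k => AddMonoidHom.mk' (fun x => tmod S R k (h x))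
      fun x y => by rw [map_add, tmod_add]) fun k l => by ext x; exact add_tmod _ _ _)
    (fun s k x => rfl) fun r k x => (op_smul_tmod r k (h x)).trans (by simp)

theorem bTensorEquiv_tensorMapRight (h : M →ₗ[R] N) (t : BTensor R K M) :
    bTensorEquiv S R K N (tensorMapRight K h t) = tensorModMap S K h (bTensorEquiv S R K M t) := by
  induction t using BTensor.induction with
  | tmul k x => rfl
  | add s t hs ht => simp only [map_add, hs, ht]

theorem tensorModMap_surjective {g : N →ₗ[R] L} (hg : Function.Surjective g) :
    Function.Surjective (tensorModMap S K g) := fun t => by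
  obtain ⟨t, rfl⟩ := (bTensorEquiv S R K L).surjective t
  obtain ⟨t, rfl⟩ := tensorMapRight_surjective (U := K) hg t
  exact ⟨bTensorEquiv S R K N t, (bTensorEquiv_tensorMapRight g t).symm⟩

theorem tensorModMap_exact {f : M →ₗ[R] N} {g : N →ₗ[R] L} (hfg : Function.Exact f g)
    (hg : Function.Surjective g) :
    Function.Exact (tensorModMap S K f) (tensorModMap S K g) := fun t => by
  obtain ⟨t, rfl⟩ := (bTensorEquiv S R K N).surjective t
  rw [← bTensorEquiv_tensorMapRight, AddEquiv.map_eq_zero_iff, tensorMapRight_exact hfg hg t]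
  constructor
  · rintro ⟨x, rfl⟩
    exact ⟨_, (bTensorEquiv_tensorMapRight f x).symm⟩
  · rintro ⟨x, hx⟩
    obtain ⟨x, rfl⟩ := (bTensorEquiv S R K M).surjective x
    rw [← bTensorEquiv_tensorMapRight] at hx
    exact ⟨x, (bTensorEquiv S R K N).injective hx⟩

theorem tensorModMap_injective {f : M →ₗ[R] N} (hf : Function.Injective (tensorMapRight K f)) :
    Function.Injective (tensorModMap S K f) := fun s t h => by
  obtain ⟨s, rfl⟩ := (bTensorEquiv S R K M).surjective s
  obtain ⟨t, rfl⟩ := (bTensorEquiv S R K M).surjective t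
  rw [← bTensorEquiv_tensorMapRight, ← bTensorEquiv_tensorMapRight] at h
  exact congrArg _ (hf ((bTensorEquiv S R K N).injective h))

end TensorMod

/-! ### Unit and counit of the adjunction -/

section HomMod

variable {S R K : Type u} [Ring S] [Ring R] [AddCommGroup K] [Module S K] [Module Rᵐᵒᵖ K]
  [SMulCommClass S Rᵐᵒᵖ K] {N : Type u} [AddCommGroup N] [Module R N]
  {I J : Type u} [AddCommGroup I] [Module S I] [AddCommGroup J] [Module S J]

variable (S R K I) in
/-- The underlying abelian group of `Hom_S(K, I)`. -/
def HomMod.toLin : HomMod S R K I ≃+ (K →ₗ[S] I) := AddEquiv.refl _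

theorem HomMod.toLin_symm_apply (f : K →ₗ[S] I) (k : K) :
    (HomMod.toLin S R K I).symm f k = f k := rfl

theorem HomMod.map_add (f : HomMod S R K I) (k l : K) : f (k + l) = f k + f l :=
  (HomMod.toLin S R K I f).map_add k l

theorem HomMod.map_smul (f : HomMod S R K I) (s : S) (k : K) : f (s • k) = s • f k :=
  (HomMod.toLin S R K I f).map_smul s k

variable (R K) in
/-- The map `Hom_S(K, I) → Hom_S(K, J)` induced by a map `I → J`. -/
def homModMap (h : I →ₗ[S] J) : HomMod S R K I →ₗ[R] HomMod S R K J where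
  toFun f := (HomMod.toLin S R K J).symm (h ∘ₗ HomMod.toLin S R K I f)
  map_add' f g := HomMod.ext S R K J fun k => h.map_add (f k) (g k)
  map_smul' _ _ := rfl

variable (S K N) in
/-- The unit `N → Hom_S(K, K ⊗_R N)`. -/
def homTensorUnit : N →ₗ[R] HomMod S R K (TensorMod S R K N) where
  toFun x := (HomMod.toLin S R K _).symm
    { toFun := fun k => tmod S R k x
      map_add' := fun k l => add_tmod k l x
      map_smul' := fun _ _ => rfl }
  map_add' x y := HomMod.ext S R K _ fun k => tmod_add k x y
  map_smul' r x := HomMod.ext S R K _ fun k => (op_smul_tmod r k x).symm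

variable (R K I) in
/-- The evaluation `K ⊗_R Hom_S(K, I) → I`. -/
def tensorHomEval : TensorMod S R K (HomMod S R K I) →ₗ[S] I :=
  TensorMod.lift
    (AddMonoidHom.mk' (fun k => AddMonoidHom.mk' (fun f => f k) fun f g => rfl) fun k l => by
      ext f; exact f.map_add k l)
    (fun s k f => f.map_smul s k) fun r k f => rfl

end HomMod

/-! ### The injective case -/

section RelativeInjective

variable {S R K : Type u} [Ring S] [Ring R] [AddCommGroup K] [Module S K] [Module Rᵐᵒᵖ K]

/-- The hypothesis `hL` says Tor_1(K,L) = 0, read off a free cover of K, so K ⊗ - keeps f injective.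
The proof is the snake chase between the rows for ker p, the free module and K. -/
theorem tensorMapRight_injective {M N L : Type u} [AddCommGroup M] [Module R M] [AddCommGroup N]
    [Module R N] [AddCommGroup L] [Module R L] {f : M →ₗ[R] N} {g : N →ₗ[R] L}
    (hf : Function.Injective f) (hfg : Function.Exact f g) (hg : Function.Surjective g) {r : ℕ}
    {p : (Fin r → Rᵐᵒᵖ) →ₗ[Rᵐᵒᵖ] K} (hp : Function.Surjective p)
    (hL : Function.Injective (tensorMap R L (LinearMap.ker p).subtype)) :
    Function.Injective (tensorMapRight K f) := by
  have hex : ∀ {N : Type u} [AddCommGroup N] [Module R N], Function.Exact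
      (tensorMap R N (LinearMap.ker p).subtype) (tensorMap R N p) := fun {N} _ _ =>
    tensorMap_exact (LinearMap.exact_subtype_ker_map p) hp
  refine (injective_iff_map_eq_zero _).2 fun t ht => ?_
  obtain ⟨a, rfl⟩ := tensorMap_surjective (N := M) hp t
  rw [← tensorMap_tensorMapRight] at ht
  obtain ⟨w, hw⟩ := (hex _).1 ht
  have hw0 : tensorMapRight (LinearMap.ker p) g w = 0 := by
    refine hL ?_
    rw [tensorMap_tensorMapRight, hw, map_zero]
    exact (tensorMapRight_exact hfg hg _).2 ⟨a, rfl⟩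
  obtain ⟨v, rfl⟩ := (tensorMapRight_exact hfg hg w).1 hw0
  rw [tensorMap_tensorMapRight] at hw
  rw [← tensorMapRight_free_injective r hf hw]
  exact (hex _).2 ⟨v, rfl⟩

variable [SMulCommClass S Rᵐᵒᵖ K] [SMulCommClass Rᵐᵒᵖ S K] {I : Type u} [AddCommGroup I]
  [Module S I] {X Y : Type u} [AddCommGroup X] [Module Rᵐᵒᵖ X] [AddCommGroup Y] [Module Rᵐᵒᵖ Y]

variable (S R K I X) in
/-- The natural map `X ⊗_R Hom_S(K, I) → Hom_S(Hom_R(X, K), I)`. -/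
def tensorHomToBidual : BTensor R X (HomMod S R K I) →ₗ[ℤ] ((X →ₗ[Rᵐᵒᵖ] K) →ₗ[S] I) :=
  BTensor.lift
    (AddMonoidHom.mk' (fun x => AddMonoidHom.mk' (fun g =>
      { toFun := fun φ => g (φ x)
        map_add' := fun φ ψ => g.map_add _ _
        map_smul' := fun s φ => g.map_smul s _ }) fun g g' => rfl) fun x y => by
      ext g φ
      exact (congrArg g (φ.map_add x y)).trans (g.map_add _ _))
    fun r x g => LinearMap.ext fun φ => congrArg g (φ.map_smul (op r) x)

theorem tensorHomToBidual_tensorMap (f : X →ₗ[Rᵐᵒᵖ] Y) (t : BTensor R X (HomMod S R K I)) :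
    tensorHomToBidual S R K I Y (tensorMap R _ f t) =
      tensorHomToBidual S R K I X t ∘ₗ LinearMap.lcomp S K f := by
  induction t using BTensor.induction with
  | tmul x g => rfl
  | add s t hs ht => rw [map_add, map_add, hs, ht, map_add, LinearMap.add_comp]

variable (S R K I) in
-- Both sides are Hom_S(K,I)^r, since the dual of the free module is K^r.
theorem tensorHomToBidual_free_bijective (r : ℕ) :
    Function.Bijective (tensorHomToBidual S R K I (Fin r → Rᵐᵒᵖ)) := by
  have key : ∀ (w : Fin r → HomMod S R K I) (φ : (Fin r → Rᵐᵒᵖ) →ₗ[Rᵐᵒᵖ] K),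
      tensorHomToBidual S R K I (Fin r → Rᵐᵒᵖ) (∑ j, btmul R (Pi.single j (1 : Rᵐᵒᵖ)) (w j)) φ =
        ∑ j, w j (φ (Pi.single j 1)) := fun w φ => by
    rw [map_sum, LinearMap.sum_apply]
    rfl
  constructor
  · refine (injective_iff_map_eq_zero _).2 fun t ht => ?_
    rw [← sum_btmul_freeTensorTo t] at ht ⊢
    refine Finset.sum_eq_zero fun j _ => ?_
    suffices freeTensorTo R (HomMod S R K I) r t j = 0 by rw [this, btmul_zero]
    refine HomMod.ext S R K I fun k => ?_
    -- Test on the functional sending the j-th basis vector to k and the others to 0.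
    have := congrArg (fun h => h (homFreeEquiv S Rᵐᵒᵖ K r (Pi.single j k))) ht
    simp only [key, homFreeEquiv_apply] at this
    rw [Finset.sum_eq_single j (fun i _ hij => by
      rw [Pi.single_eq_of_ne hij]; exact (HomMod.toLin S R K I _).map_zero) (by simp),
      Pi.single_eq_same] at this
    exact this
  · intro h
    refine ⟨∑ j, btmul R (Pi.single j (1 : Rᵐᵒᵖ)) ((HomMod.toLin S R K I).symm
      (h ∘ₗ (homFreeEquiv S Rᵐᵒᵖ K r).toLinearMap ∘ₗ LinearMap.single S (fun _ => K) j)),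
      LinearMap.ext fun φ => ?_⟩
    rw [key]
    obtain ⟨w, rfl⟩ := (homFreeEquiv S Rᵐᵒᵖ K r).surjective φ
    simp only [HomMod.toLin_symm_apply, LinearMap.comp_apply, homFreeEquiv_apply,
      LinearEquiv.coe_coe, LinearMap.single_apply]
    rw [← map_sum, ← map_sum, Finset.univ_sum_single]

section

variable {d : ℕ} (hK : ∀ n, NPres S n K) (hI : ExtAcyclic S K I d)

include hK hI

theorem DualFinite.tensorHomToBidual_surjective (hX : DualFinite S Rᵐᵒᵖ K X) :
    Function.Surjective (tensorHomToBidual S R K I X) := fun h => by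
  obtain ⟨r, f, hf, hk⟩ := hX.exists_ker hK
  obtain ⟨h', rfl⟩ := hX.exists_extension hK hI hf hk h
  obtain ⟨t, rfl⟩ := (tensorHomToBidual_free_bijective S R K I r).2 h'
  exact ⟨tensorMap R _ f t, tensorHomToBidual_tensorMap f t⟩

/-- Four lemma: injectivity for X follows from bijectivity on the free cover and surjectivity for
the syzygy, which lies in the same class. -/
theorem DualFinite.tensorHomToBidual_bijective (hX : DualFinite S Rᵐᵒᵖ K X) :
    Function.Bijective (tensorHomToBidual S R K I X) := by
  refine ⟨(injective_iff_map_eq_zero _).2 fun t ht => ?_, hX.tensorHomToBidual_surjective hK hI⟩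
  obtain ⟨r, f, hf, hk⟩ := hX.exists_ker hK
  obtain ⟨p, rfl⟩ := tensorMap_surjective hf t
  rw [tensorHomToBidual_tensorMap] at ht
  have hex := LinearMap.exact_subtype_ker_map f
  have hs := lcomp_surjective (A := S) (Submodule.subtype_injective _) hex hf (hX.ext 0)
  -- The functional attached to p vanishes on X*, hence factors through the quotient (ker f)* of the
  -- dual of the free module.
  have hle : LinearMap.ker (LinearMap.lcomp S K (LinearMap.ker f).subtype) ≤
      LinearMap.ker (tensorHomToBidual S R K I _ p) := fun φ hφ => by
    obtain ⟨ψ, rfl⟩ := (lcomp_exact (A := S) hex hf φ).1 hφ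
    exact congrArg (fun t => t ψ) ht
  let q := (LinearMap.lcomp S K (LinearMap.ker f).subtype).quotKerEquivOfSurjective hs
  obtain ⟨w, hw⟩ := hk.tensorHomToBidual_surjective hK hI
    ((LinearMap.ker _).liftQ (tensorHomToBidual S R K I _ p) hle ∘ₗ q.symm.toLinearMap)
  have hwp : tensorMap R _ (LinearMap.ker f).subtype w = p := by
    refine (tensorHomToBidual_free_bijective S R K I r).1 ?_
    rw [tensorHomToBidual_tensorMap, hw]
    ext φ
    have : q.symm (LinearMap.lcomp S K (LinearMap.ker f).subtype φ) = Submodule.mkQ _ φ := by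
      rw [LinearEquiv.symm_apply_eq]; rfl
    rw [LinearMap.comp_apply, LinearMap.comp_apply, LinearEquiv.coe_coe, this]
    rfl
  rw [← hwp]
  exact (tensorMap_exact hex hf _).2 ⟨w, rfl⟩

/-- This is Tor_1(X, Hom_S(K,I)) = 0. Under the bidual isomorphisms the map becomes precomposition
with the surjection from the dual of the free module onto (ker f)*. -/
theorem DualFinite.tensorMap_ker_injective (hX : DualFinite S Rᵐᵒᵖ K X) {r : ℕ}
    {f : (Fin r → Rᵐᵒᵖ) →ₗ[Rᵐᵒᵖ] X} (hf : Function.Surjective f)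
    (hk : DualFinite S Rᵐᵒᵖ K (LinearMap.ker f)) :
    Function.Injective (tensorMap R (HomMod S R K I) (LinearMap.ker f).subtype) := by
  refine (injective_iff_map_eq_zero _).2 fun t ht => ?_
  refine (injective_iff_map_eq_zero _).1 (hk.tensorHomToBidual_bijective hK hI).1 t ?_
  have h : tensorHomToBidual S R K I _ t ∘ₗ LinearMap.lcomp S K (LinearMap.ker f).subtype = 0 := by
    rw [← tensorHomToBidual_tensorMap, ht, map_zero]
  ext φ
  obtain ⟨ψ, rfl⟩ := lcomp_surjective (A := S) (Submodule.subtype_injective _)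
    (LinearMap.exact_subtype_ker_map f) hf (hX.ext 0) φ
  exact congrArg (fun t => t ψ) h

/-- Evaluation is the bidual map at X = K followed by Hom_S(Hom_R(K,K), I) ≅ Hom_S(S, I) ≅ I, that
is, by evaluation at the identity. -/
theorem tensorHomEval_bijective
    (hhom : Function.Bijective fun s : S => (DistribSMul.toLinearMap Rᵐᵒᵖ K s : K →ₗ[Rᵐᵒᵖ] K))
    (hX : DualFinite S Rᵐᵒᵖ K K) : Function.Bijective (tensorHomEval (S := S) R K I) := by
  have key : ∀ t, tensorHomEval R K I (bTensorEquiv S R K _ t) =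
      tensorHomToBidual S R K I K t LinearMap.id := fun t => by
    induction t using BTensor.induction with
    | tmul k g => rfl
    | add s t hs ht => simp only [map_add, hs, ht, LinearMap.add_apply]
  let e := homothetyEquiv (A := S) hhom
  have he : ∀ φ, φ = e.symm φ • LinearMap.id := fun φ => by
    obtain ⟨s, rfl⟩ := e.surjective φ
    rw [e.symm_apply_apply]
    rfl
  constructor
  · refine (injective_iff_map_eq_zero _).2 fun t ht => ?_
    obtain ⟨t, rfl⟩ := (bTensorEquiv S R K _).surjective t
    rw [key] at ht
    suffices t = 0 by rw [this, map_zero]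
    refine (injective_iff_map_eq_zero _).1 (hX.tensorHomToBidual_bijective hK hI).1 t ?_
    ext φ
    rw [he φ, map_smul, ht, smul_zero]
    rfl
  · intro y
    obtain ⟨t, ht⟩ := hX.tensorHomToBidual_surjective hK hI
      ((LinearMap.toSpanSingleton S I y) ∘ₗ e.symm.toLinearMap)
    refine ⟨bTensorEquiv S R K _ t, ?_⟩
    rw [key, ht]
    have : e.symm LinearMap.id = 1 := by
      rw [LinearEquiv.symm_apply_eq]
      ext k
      exact (one_smul S k).symm
    simp [this]

end

omit [SMulCommClass Rᵐᵒᵖ S K] in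
-- Triangle identity: the unit is a section of Hom_S(K, evaluation), which is injective.
theorem homTensorUnit_homMod_bijective (h : Function.Bijective (tensorHomEval (S := S) R K I)) :
    Function.Bijective (homTensorUnit (R := R) S K (HomMod S R K I)) := by
  have hc : ∀ f, homModMap R K (tensorHomEval R K I) (homTensorUnit S K (HomMod S R K I) f) = f :=
    fun f => rfl
  have hi : Function.Injective (homModMap R K (tensorHomEval R K I)) := fun f g hfg =>
    HomMod.ext S R K _ fun k => h.1 (congrArg (fun t : HomMod S R K I => t k) hfg)
  exact ⟨Function.LeftInverse.injective hc, fun f => ⟨_, hi (hc _)⟩⟩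

theorem isRelNDInjective_extension {n d : ℕ} (hK : ∀ n, NPres S n K)
    (hhom : Function.Bijective fun s : S => (DistribSMul.toLinearMap Rᵐᵒᵖ K s : K →ₗ[Rᵐᵒᵖ] K))
    (hX : DualFinite S Rᵐᵒᵖ K K)
    (hI : ∀ (I : Type u) [AddCommGroup I] [Module S I], IsNDInjective S n d I → ExtAcyclic S K I d)
    {M N L : Type u} [AddCommGroup M] [AddCommGroup N] [AddCommGroup L] [Module R M] [Module R N]
    [Module R L] {f : M →ₗ[R] N} {g : N →ₗ[R] L} (hf : Function.Injective f)
    (hfg : Function.Exact f g) (hg : Function.Surjective g) (hM : IsRelNDInjective S R K n d M)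
    (hL : IsRelNDInjective S R K n d L) : IsRelNDInjective S R K n d N := by
  obtain ⟨I, _, _, hInd, ⟨eM⟩⟩ := hM
  obtain ⟨J, _, _, hJnd, ⟨eL⟩⟩ := hL
  let f' : HomMod S R K I →ₗ[R] N := f ∘ₗ eM.symm.toLinearMap
  let g' : N →ₗ[R] HomMod S R K J := eL.toLinearMap ∘ₗ g
  have hf' : Function.Injective f' := hf.comp eM.symm.injective
  have hg' : Function.Surjective g' := eL.surjective.comp hg
  have hfg' : Function.Exact f' g' := fun x => by
    rw [show g' x = eL (g x) from rfl, LinearEquiv.map_eq_zero_iff, hfg x]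
    exact ⟨fun ⟨y, hy⟩ => ⟨eM y, by simp [f', hy]⟩, fun ⟨y, hy⟩ => ⟨eM.symm y, hy⟩⟩
  have hevI := tensorHomEval_bijective hK (hI I hInd) hhom hX
  have hevJ := tensorHomEval_bijective hK (hI J hJnd) hhom hX
  have hηI := homTensorUnit_homMod_bijective hevI
  have hηJ := homTensorUnit_homMod_bijective hevJ
  obtain ⟨r, p, hp, hk⟩ := hX.exists_ker hK
  have hTf : Function.Injective (tensorModMap S K f') := tensorModMap_injective
    (tensorMapRight_injective hf' hfg' hg' hp (hX.tensorMap_ker_injective hK (hI J hJnd) hp hk))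
  have hTfg := tensorModMap_exact (S := S) (K := K) hfg' hg'
  -- K ⊗ N is an extension of K ⊗ Hom_S(K,J) ≅ J by K ⊗ Hom_S(K,I) ≅ I. The unit at N is compared
  -- with the bijective units at both ends.
  refine ⟨TensorMod S R K N, inferInstance, inferInstance, ?_, ⟨LinearEquiv.ofBijective
    (homTensorUnit S K N) ⟨(injective_iff_map_eq_zero _).2 fun x hx => ?_, fun h => ?_⟩⟩⟩
  · exact IsNDInjective.extension hTf hTfg (tensorModMap_surjective hg')
      (hInd.congr (LinearEquiv.ofBijective _ hevI).symm)
      (hJnd.congr (LinearEquiv.ofBijective _ hevJ).symm)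
  · have hgx : g' x = 0 := (injective_iff_map_eq_zero _).1 hηJ.1 _ <| HomMod.ext S R K _ fun k =>
      (congrArg (fun h : HomMod S R K (TensorMod S R K N) => tensorModMap S K g' (h k)) hx).trans
        (map_zero _)
    obtain ⟨y, rfl⟩ := (hfg' x).1 hgx
    have hy : y = 0 := (injective_iff_map_eq_zero _).1 hηI.1 _ <| HomMod.ext S R K _ fun k =>
      hTf <| (congrArg (fun h : HomMod S R K (TensorMod S R K N) => h k) hx).trans
        (map_zero (tensorModMap S K f')).symm
    rw [hy, map_zero]
  -- Correct h by the unit at a lift x: the difference takes values in the image of K ⊗ Hom_S(K,I),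
  -- hence comes from the unit there. Left exactness of Hom_S(K,-) suffices.
  · obtain ⟨z, hz⟩ := hηJ.2 (homModMap R K (tensorModMap S K g') h)
    obtain ⟨x, rfl⟩ := hg' z
    have hd : ∀ k, tensorModMap S K g'
        ((h - homTensorUnit S K N x : HomMod S R K (TensorMod S R K N)) k) = 0 := fun k => by
      have := congrArg (fun t : HomMod S R K _ => t k) hz
      change tensorModMap S K g' (h k - tmod S R k x) = 0
      rw [map_sub, sub_eq_zero]
      exact this.symm
    let e := LinearEquiv.ofInjective _ hTf
    let φ : K →ₗ[S] LinearMap.range (tensorModMap S K f') :=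
      LinearMap.codRestrict _ (HomMod.toLin S R K _ (h - homTensorUnit S K N x))
        fun k => (hTfg _).1 (hd k)
    obtain ⟨y, hy⟩ := hηI.2 ((HomMod.toLin S R K _).symm (e.symm.toLinearMap ∘ₗ φ))
    refine ⟨x + f' y, ?_⟩
    rw [map_add]
    refine eq_sub_iff_add_eq'.1 (HomMod.ext S R K _ fun k => ?_)
    have h1 : tmod S R k y = e.symm (φ k) := congrArg (fun t : HomMod S R K _ => t k) hy
    have h2 : tensorModMap S K f' (tmod S R k y) = φ k := by
      rw [h1]
      exact congrArg Subtype.val (e.apply_symm_apply (φ k))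
    exact h2

end RelativeInjective

/-! ### The flat case -/

section RelativeFlat

variable {S R K : Type u} [Ring S] [Ring R] [AddCommGroup K] [Module S K] [Module Rᵐᵒᵖ K]
  [SMulCommClass S Rᵐᵒᵖ K] {F : Type u} [AddCommGroup F]
  [Module R F] {X Y : Type u} [AddCommGroup X] [Module S X] [AddCommGroup Y] [Module S Y]

variable (S R K F X) in
/-- The natural map `Hom_S(X, K) ⊗_R F → Hom_S(X, K ⊗_R F)`. -/
def homTensorToHom : BTensor R (X →ₗ[S] K) F →ₗ[ℤ] (X →ₗ[S] TensorMod S R K F) :=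
  BTensor.lift
    (AddMonoidHom.mk' (fun φ => AddMonoidHom.mk' (fun y =>
      { toFun := fun x => tmod S R (φ x) y
        map_add' := fun a b => by rw [map_add, add_tmod]
        map_smul' := fun s a => by rw [map_smul]; rfl }) fun y z =>
          LinearMap.ext fun x => tmod_add (φ x) y z) fun φ ψ => by
      ext y x
      exact add_tmod (φ x) (ψ x) y)
    fun r φ y => LinearMap.ext fun x => op_smul_tmod r (φ x) y

theorem homTensorToHom_btmul (φ : X →ₗ[S] K) (y : F) (x : X) :
    homTensorToHom S R K F X (btmul R φ y) x = tmod S R (φ x) y := rfl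

theorem homTensorToHom_tensorMap_lcomp (f : X →ₗ[S] Y) (t : BTensor R (Y →ₗ[S] K) F) :
    homTensorToHom S R K F X (tensorMap R F (LinearMap.lcomp Rᵐᵒᵖ K f) t) =
      homTensorToHom S R K F Y t ∘ₗ f := by
  induction t using BTensor.induction with
  | tmul x g => rfl
  | add s t hs ht => rw [map_add, map_add, hs, ht, map_add, LinearMap.add_comp]

/-- The coordinate inclusion `K → Hom_S(S^r, K)`. -/
def homFreeSingle (S R K : Type u) [Ring S] [Ring R] [AddCommGroup K] [Module S K] [Module Rᵐᵒᵖ K]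
    [SMulCommClass S Rᵐᵒᵖ K] {r : ℕ} (j : Fin r) : K →ₗ[Rᵐᵒᵖ] ((Fin r → S) →ₗ[S] K) :=
  (homFreeEquiv Rᵐᵒᵖ S K r).toLinearMap ∘ₗ LinearMap.single Rᵐᵒᵖ (fun _ => K) j

theorem homFreeSingle_apply {r : ℕ} (i j : Fin r) (k : K) :
    homFreeSingle S R K j k (Pi.single i 1) = (Pi.single j k : Fin r → K) i :=
  homFreeEquiv_apply (A := Rᵐᵒᵖ) _ _

variable (S R K F) in
theorem homTensorToHom_free_bijective (r : ℕ) :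
    Function.Bijective (homTensorToHom S R K F (Fin r → S)) := by
  -- The candidate inverse: each value of h on a basis vector is placed in the corresponding
  -- coordinate copy of K.
  let σ : ((Fin r → S) →ₗ[S] TensorMod S R K F) → BTensor R ((Fin r → S) →ₗ[S] K) F := fun h =>
    ∑ j, tensorMap R F (homFreeSingle S R K j) ((bTensorEquiv S R K F).symm (h (Pi.single j 1)))
  have hσ_add : ∀ h h', σ (h + h') = σ h + σ h' := fun h h' => by
    simp only [σ, LinearMap.add_apply, map_add, Finset.sum_add_distrib]
  have hl : Function.LeftInverse σ (homTensorToHom S R K F (Fin r → S)) := fun t => by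
    induction t using BTensor.induction with
    | tmul φ y =>
      have : ∀ j : Fin r, (bTensorEquiv S R K F).symm
          (homTensorToHom S R K F (Fin r → S) (btmul R φ y) (Pi.single j 1)) =
          btmul R (φ (Pi.single j 1)) y := fun j => by
        rw [AddEquiv.symm_apply_eq]; rfl
      simp only [σ, this, tensorMap_btmul]
      rw [← sum_btmul]
      congr 1
      obtain ⟨w, rfl⟩ := (homFreeEquiv Rᵐᵒᵖ S K r).surjective φ
      simp only [homFreeEquiv_apply, homFreeSingle, LinearMap.comp_apply, LinearEquiv.coe_coe,
        LinearMap.single_apply]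
      rw [← map_sum, Finset.univ_sum_single]
    | add s t hs ht => rw [map_add, hσ_add, hs, ht]
  have hs : ∀ (j i : Fin r) (t : BTensor R K F), homTensorToHom S R K F (Fin r → S)
      (tensorMap R F (homFreeSingle S R K j) t) (Pi.single i 1) =
        (Pi.single j (bTensorEquiv S R K F t) : Fin r → TensorMod S R K F) i := fun j i t => by
    induction t using BTensor.induction with
    | tmul k y =>
      rw [tensorMap_btmul, homTensorToHom_btmul, homFreeSingle_apply, bTensorEquiv_btmul]
      by_cases h : i = j
      · subst h; simp
      · rw [Pi.single_eq_of_ne h, Pi.single_eq_of_ne h, ← bTensorEquiv_btmul, zero_btmul, map_zero]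
    | add s t hs ht =>
      rw [map_add, map_add, LinearMap.add_apply, hs, ht, map_add, Pi.single_add, Pi.add_apply]
  refine ⟨hl.injective, fun h => ⟨σ h, (Pi.basisFun S (Fin r)).ext fun i => ?_⟩⟩
  rw [Pi.basisFun_apply]
  simp only [σ, map_sum, LinearMap.sum_apply, hs, AddEquiv.apply_symm_apply]
  rw [← Finset.sum_apply, Finset.univ_sum_single]

section

variable {d : ℕ} (hK : ∀ n, NPres Rᵐᵒᵖ n K) (hF : ExtAcyclic Rᵐᵒᵖ K (CharDual F) d)

include hK hF

/-- X* ⊗ F embeds in (S^r)* ⊗ F, because maps from X* to the character module of F extend to (S^r)*;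
the free case concludes. -/
theorem DualFinite.homTensorToHom_injective (hX : DualFinite Rᵐᵒᵖ S K X) :
    Function.Injective (homTensorToHom S R K F X) := by
  obtain ⟨r, f, hf, hk⟩ := hX.exists_ker hK
  have hi : Function.Injective (tensorMap R F (LinearMap.lcomp Rᵐᵒᵖ K f)) :=
    tensorMap_injective_of_extension fun h => hX.exists_extension hK hF hf hk h
  refine (injective_iff_map_eq_zero _).2 fun t ht => ?_
  refine (injective_iff_map_eq_zero _).1 hi t ?_
  refine (injective_iff_map_eq_zero _).1 (homTensorToHom_free_bijective S R K F r).1 _ ?_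
  rw [homTensorToHom_tensorMap_lcomp, ht, LinearMap.zero_comp]

theorem DualFinite.homTensorToHom_bijective (hX : DualFinite Rᵐᵒᵖ S K X) :
    Function.Bijective (homTensorToHom S R K F X) := by
  refine ⟨hX.homTensorToHom_injective hK hF, fun h => ?_⟩
  obtain ⟨r, f, hf, hk⟩ := hX.exists_ker hK
  have hex := LinearMap.exact_subtype_ker_map f
  obtain ⟨t, ht⟩ := (homTensorToHom_free_bijective S R K F r).2 (h ∘ₗ f)
  have h0 : tensorMap R F (LinearMap.lcomp Rᵐᵒᵖ K (LinearMap.ker f).subtype) t = 0 := by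
    refine (injective_iff_map_eq_zero _).1 (hk.homTensorToHom_injective hK hF) _ ?_
    rw [homTensorToHom_tensorMap_lcomp, ht]
    ext x
    exact (congrArg h x.2).trans (map_zero h)
  obtain ⟨s, rfl⟩ := (tensorMap_exact (lcomp_exact hex hf)
    (lcomp_surjective (Submodule.subtype_injective _) hex hf (hX.ext 0)) t).1 h0
  rw [homTensorToHom_tensorMap_lcomp] at ht
  exact ⟨s, LinearMap.cancel_right hf |>.1 ht⟩

/-- This is Ext^1_S(X, K ⊗ F) = 0. Maps from ker f to K ⊗ F come from (ker f)* ⊗ F, onto which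
(S^r)* ⊗ F surjects. -/
theorem DualFinite.exists_extension_tensorMod (hX : DualFinite Rᵐᵒᵖ S K X) :
    ∃ (r : ℕ) (f : (Fin r → S) →ₗ[S] X), Function.Surjective f ∧
      ∀ h : LinearMap.ker f →ₗ[S] TensorMod S R K F,
        ∃ h' : (Fin r → S) →ₗ[S] TensorMod S R K F, h' ∘ₗ (LinearMap.ker f).subtype = h := by
  obtain ⟨r, f, hf, hk⟩ := hX.exists_ker hK
  refine ⟨r, f, hf, fun h => ?_⟩
  obtain ⟨t, rfl⟩ := (hk.homTensorToHom_bijective hK hF).2 h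
  obtain ⟨s, rfl⟩ := tensorMap_surjective (lcomp_surjective (A := Rᵐᵒᵖ)
    (Submodule.subtype_injective _) (LinearMap.exact_subtype_ker_map f) hf (hX.ext 0)) t
  exact ⟨_, (homTensorToHom_tensorMap_lcomp _ s).symm⟩

theorem DualFinite.exists_lift {N L : Type u} [AddCommGroup N] [AddCommGroup L] [Module S N]
    [Module S L] {i : TensorMod S R K F →ₗ[S] N} {g : N →ₗ[S] L} (hi : Function.Injective i)
    (hig : Function.Exact i g) (hg : Function.Surjective g) (hX : DualFinite Rᵐᵒᵖ S K X)
    (φ : X →ₗ[S] L) : ∃ ψ : X →ₗ[S] N, g ∘ₗ ψ = φ := by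
  obtain ⟨r, f, hf, hext⟩ := hX.exists_extension_tensorMod hK hF
  obtain ⟨l, hl⟩ := Module.projective_lifting_property g (φ ∘ₗ f) hg
  have hl' : ∀ v, g (l v) = φ (f v) := fun v => congrArg (fun t => t v) hl
  -- The lift l carries ker f into the image of i. Extending that restriction to m makes l - i ∘ m
  -- vanish on ker f, so it descends to X.
  let e := LinearEquiv.ofInjective i hi
  obtain ⟨m, hm⟩ := hext (e.symm.toLinearMap ∘ₗ LinearMap.codRestrict _
    (l ∘ₗ (LinearMap.ker f).subtype) fun v => (hig _).1 (by
      change g (l v) = 0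
      rw [hl', show f v = 0 from v.2, map_zero]))
  have hm' : ∀ v ∈ LinearMap.ker f, i (m v) = l v := fun v hv => by
    have : m v = e.symm _ := congrArg (fun t => t ⟨v, hv⟩) hm
    rw [this]
    exact congrArg Subtype.val (e.apply_symm_apply _)
  have hker : LinearMap.ker f ≤ LinearMap.ker (l - i ∘ₗ m) := fun v hv => by
    rw [LinearMap.mem_ker, LinearMap.sub_apply, LinearMap.comp_apply, hm' v hv, sub_self]
  let q := f.quotKerEquivOfSurjective hf
  refine ⟨(LinearMap.ker f).liftQ (l - i ∘ₗ m) hker ∘ₗ q.symm.toLinearMap, LinearMap.ext fun x => ?_⟩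
  obtain ⟨v, rfl⟩ := hf x
  have hq : q.symm (f v) = (LinearMap.ker f).mkQ v := by
    rw [LinearEquiv.symm_apply_eq]; rfl
  rw [LinearMap.comp_apply, LinearMap.comp_apply, LinearEquiv.coe_coe, hq]
  change g (l v - i (m v)) = _
  rw [map_sub, hl', (hig _).2 ⟨m v, rfl⟩, sub_zero]

/-- The unit is F ≅ Hom_S(K,K) ⊗ F → Hom_S(K, K ⊗ F), with x going to id ⊗ x in the middle. -/
theorem homTensorUnit_bijective [SMulCommClass Rᵐᵒᵖ S K]
    (hhom : Function.Bijective fun r : Rᵐᵒᵖ => (DistribSMul.toLinearMap S K r : K →ₗ[S] K))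
    (hX : DualFinite Rᵐᵒᵖ S K K) : Function.Bijective (homTensorUnit (R := R) S K F) := by
  let e := homothetyEquiv (A := Rᵐᵒᵖ) hhom
  have hc : ∀ x : F, homTensorUnit S K F x = (HomMod.toLin S R K _).symm
      (homTensorToHom S R K F K (btmul R LinearMap.id x)) := fun x => rfl
  have key : ∀ t : BTensor R (K →ₗ[S] K) F, ∃ x, t = btmul R LinearMap.id x := fun t => by
    induction t using BTensor.induction with
    | tmul φ x =>
      obtain ⟨r, rfl⟩ := e.surjective φ
      have : e r = r • LinearMap.id := rfl
      exact ⟨unop r • x, by rw [this, ← smul_btmul, op_unop]⟩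
    | add s t hs ht =>
      obtain ⟨x, rfl⟩ := hs
      obtain ⟨y, rfl⟩ := ht
      exact ⟨x + y, (btmul_add _ _ _).symm⟩
  constructor
  · intro x y hxy
    rw [hc, hc] at hxy
    have h := (hX.homTensorToHom_bijective hK hF).1 ((HomMod.toLin S R K _).symm.injective hxy)
    -- Retraction of x ↦ id ⊗ x: an endomorphism of K is traded for the scalar whose homothety it
    -- is.
    let c : BTensor R (K →ₗ[S] K) F →ₗ[ℤ] F := BTensor.lift
      (AddMonoidHom.mk' (fun φ => AddMonoidHom.mk' (fun x => unop (e.symm φ) • x)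
        fun x y => smul_add _ x y) fun φ ψ => by ext x; simp [add_smul])
      fun r φ x => by simp [mul_smul]
    have h1 : e.symm LinearMap.id = 1 := by
      rw [LinearEquiv.symm_apply_eq]
      ext k
      exact (one_smul Rᵐᵒᵖ k).symm
    have hcx : ∀ x, c (btmul R LinearMap.id x) = x := fun x => by
      change unop (e.symm LinearMap.id) • x = x
      rw [h1, unop_one, one_smul]
    rw [← hcx x, h, hcx]
  · intro h
    obtain ⟨t, ht⟩ := (hX.homTensorToHom_bijective hK hF).2 (HomMod.toLin S R K _ h)
    obtain ⟨x, rfl⟩ := key t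
    exact ⟨x, by rw [hc, ht, AddEquiv.symm_apply_apply]⟩

end

theorem isRelNDFlat_extension [SMulCommClass Rᵐᵒᵖ S K] {n d : ℕ} (hK : ∀ n, NPres Rᵐᵒᵖ n K)
    (hhom : Function.Bijective fun r : Rᵐᵒᵖ => (DistribSMul.toLinearMap S K r : K →ₗ[S] K))
    (hX : DualFinite Rᵐᵒᵖ S K K)
    (hI : ∀ (I : Type u) [AddCommGroup I] [Module Rᵐᵒᵖ I], IsNDInjective Rᵐᵒᵖ n d I →
      ExtAcyclic Rᵐᵒᵖ K I d)
    {M N L : Type u} [AddCommGroup M] [AddCommGroup N] [AddCommGroup L] [Module S M] [Module S N]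
    [Module S L] {f : M →ₗ[S] N} {g : N →ₗ[S] L} (hf : Function.Injective f)
    (hfg : Function.Exact f g) (hg : Function.Surjective g) (hM : IsRelNDFlat S R K n d M)
    (hL : IsRelNDFlat S R K n d L) : IsRelNDFlat S R K n d N := by
  obtain ⟨F, _, _, hFnd, ⟨eM⟩⟩ := hM
  obtain ⟨G, _, _, hGnd, ⟨eL⟩⟩ := hL
  let f' : TensorMod S R K F →ₗ[S] N := f ∘ₗ eM.symm.toLinearMap
  let g' : N →ₗ[S] TensorMod S R K G := eL.toLinearMap ∘ₗ g
  have hf' : Function.Injective f' := hf.comp eM.symm.injective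
  have hg' : Function.Surjective g' := eL.surjective.comp hg
  have hfg' : Function.Exact f' g' := fun x => by
    rw [show g' x = eL (g x) from rfl, LinearEquiv.map_eq_zero_iff, hfg x]
    exact ⟨fun ⟨y, hy⟩ => ⟨eM y, by simp [f', hy]⟩, fun ⟨y, hy⟩ => ⟨eM.symm y, hy⟩⟩
  have hF := hI _ (isNDFlat_iff_charDual.1 hFnd)
  have hG := hI _ (isNDFlat_iff_charDual.1 hGnd)
  let ηF := LinearEquiv.ofBijective (homTensorUnit (R := R) S K F)
    (homTensorUnit_bijective hK hF hhom hX)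
  let ηG := LinearEquiv.ofBijective (homTensorUnit (R := R) S K G)
    (homTensorUnit_bijective hK hG hhom hX)
  let p : F →ₗ[R] HomMod S R K N := homModMap R K f' ∘ₗ ηF.toLinearMap
  -- With p, this is Hom_S(K,-) applied to the sequence, its ends identified with F and G by the
  -- units.
  let q : HomMod S R K N →ₗ[R] G := ηG.symm.toLinearMap ∘ₗ homModMap R K g'
  have hηq : ∀ h, homTensorUnit S K G (q h) = homModMap R K g' h := fun h =>
    ηG.apply_symm_apply _
  have hp : Function.Injective p := by
    refine Function.Injective.comp (g := homModMap R K f') (fun a b hab => ?_) ηF.injective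
    exact HomMod.ext S R K _ fun k => hf' (congrArg (fun t : HomMod S R K N => t k) hab)
  have hq : Function.Surjective q := by
    refine ηG.symm.surjective.comp fun φ => ?_
    obtain ⟨ψ, hψ⟩ := hX.exists_lift hK hF hf' hfg' hg' (HomMod.toLin S R K _ φ)
    exact ⟨(HomMod.toLin S R K _).symm ψ, hψ⟩
  have hpq : Function.Exact p q := by
    intro h
    constructor
    · intro hh
      have hgh : ∀ k, g' (h k) = 0 := fun k => by
        have := hηq h
        rw [hh, map_zero] at this
        exact (congrArg (fun t : HomMod S R K (TensorMod S R K G) => t k) this).symm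
      let e := LinearEquiv.ofInjective f' hf'
      let φ : K →ₗ[S] LinearMap.range f' :=
        LinearMap.codRestrict _ (HomMod.toLin S R K _ h) fun k => (hfg' _).1 (hgh k)
      refine ⟨ηF.symm ((HomMod.toLin S R K _).symm (e.symm.toLinearMap ∘ₗ φ)), ?_⟩
      refine HomMod.ext S R K _ fun k => ?_
      rw [show p _ = homModMap R K f' (ηF (ηF.symm _)) from rfl, ηF.apply_symm_apply]
      exact congrArg Subtype.val (e.apply_symm_apply (φ k))
    · rintro ⟨x, rfl⟩
      refine (LinearEquiv.map_eq_zero_iff ηG).1 ?_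
      refine (hηq _).trans (HomMod.ext S R K _ fun k => ?_)
      exact (hfg' _).2 ⟨_, rfl⟩
  -- Evaluation at N maps the tensored sequence to the original one, with identities at the ends.
  -- The five lemma chase needs only injectivity of f', not of the map K ⊗ p.
  have hep : ∀ t, tensorHomEval R K N (tensorModMap S K p t) = f' t := fun t => by
    induction t using TensorMod.induction with
    | tmul k x => rfl
    | add s t hs ht => simp only [map_add, hs, ht]
  have heq : ∀ t, g' (tensorHomEval R K N t) = tensorModMap S K q t := fun t => by
    induction t using TensorMod.induction with
    | tmul k h =>
      exact (congrArg (fun t : HomMod S R K (TensorMod S R K G) => t k) (hηq h)).symm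
    | add s t hs ht => simp only [map_add, hs, ht]
  refine ⟨HomMod S R K N, inferInstance, inferInstance, hFnd.extension hp hpq hq hGnd,
    ⟨(LinearEquiv.ofBijective (tensorHomEval R K N) ⟨?_, ?_⟩).symm⟩⟩
  · refine (injective_iff_map_eq_zero _).2 fun t ht => ?_
    obtain ⟨s, rfl⟩ := (tensorModMap_exact (S := S) (K := K) hpq hq t).1 (by
      rw [← heq, ht, map_zero])
    rw [hep] at ht
    rw [(injective_iff_map_eq_zero _).1 hf' s ht, map_zero]
  · intro x
    obtain ⟨t, ht⟩ := tensorModMap_surjective (S := S) (K := K) hq (g' x)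
    obtain ⟨s, hs⟩ := (hfg' (x - tensorHomEval R K N t)).1 (by
      rw [map_sub, heq, ht, sub_self])
    exact ⟨t + tensorModMap S K p s, by rw [map_add, hep, hs, add_sub_cancel]⟩

end RelativeFlat

end NDModules

end

/-! ### The proposition -/

theorem mainTheorem12 (S R : Type u) [Ring S] [Ring R] (n d : ℕ) (hd : 1 ≤ d) (hn : d + 1 < n)
    (C : Type u) [AddCommGroup C] [Module S C] [Module Rᵐᵒᵖ C] [SMulCommClass S Rᵐᵒᵖ C]
    (K : Type u) [AddCommGroup K] [Module S K] [Module Rᵐᵒᵖ K] [SMulCommClass S Rᵐᵒᵖ K]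
    (hK : NDModules.IsSpecialSemidualizing S R d C K) :
    (∀ (M N L : Type u) [AddCommGroup M] [AddCommGroup N] [AddCommGroup L]
        [Module R M] [Module R N] [Module R L] (f : M →ₗ[R] N) (g : N →ₗ[R] L),
        Function.Injective f → Function.Exact f g → Function.Surjective g →
        NDModules.IsRelNDInjective S R K n d M → NDModules.IsRelNDInjective S R K n d L →
        NDModules.IsRelNDInjective S R K n d N) ∧
    (∀ (M N L : Type u) [AddCommGroup M] [AddCommGroup N] [AddCommGroup L]
        [Module S M] [Module S N] [Module S L] (f : M →ₗ[S] N) (g : N →ₗ[S] L),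
        Function.Injective f → Function.Exact f g → Function.Surjective g →
        NDModules.IsRelNDFlat S R K n d M → NDModules.IsRelNDFlat S R K n d L →
        NDModules.IsRelNDFlat S R K n d N) := by
  have : SMulCommClass Rᵐᵒᵖ S K := SMulCommClass.symm S Rᵐᵒᵖ K
  have hS := hK.syzygy_left.superFinitelyPresented
  have hR := hK.syzygy_right.superFinitelyPresented
  have hD := hK.semidualizing
  constructor
  -- Duals are taken over R in the first part and over S in the second, with the two sides of K
  -- exchanged.
  · intro M N L _ _ _ _ _ _ f g hf hfg hg hM hL
    exact NDModules.isRelNDInjective_extension hS.nPres hD.homothety_left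
      (NDModules.DualFinite.self hD.homothety_left hR fun j => hD.ext_right (j + 1) (by omega))
      (fun I _ _ hI => hI.extAcyclic hd hK.syzygy_left) hf hfg hg hM hL
  · intro M N L _ _ _ _ _ _ f g hf hfg hg hM hL
    have hhom : Function.Bijective
        fun r : Rᵐᵒᵖ => (DistribSMul.toLinearMap S K r : K →ₗ[S] K) :=
      -- The right homothety is indexed by R; it is reindexed by the opposite ring to become linear.
      hD.homothety_right.comp opEquiv.symm.bijective
    exact NDModules.isRelNDFlat_extension hR.nPres hhom
      (NDModules.DualFinite.self hhom hS fun j => hD.ext_left (j + 1) (by omega))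
      (fun I _ _ hI => hI.extAcyclic hd hK.syzygy_right) hf hfg hg hM hL
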